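/- Let $d,\kappa\ge 1$ be integers, $q\in(2,\infty)$ and $p=q'=q/(q-1)$. Write $\mathbb T=\mathbb R/\mathbb Z$. Equip $\mathbb Z^\kappa\times\mathbb R^d$ with the product of counting measure and Lebesgue measure, and $\mathbb T^\kappa\times\mathbb R^d$ with the product of the Haar probability measure and Lebesgue measure; $|\cdot|$ denotes the measure of a set. For $g$ on $\mathbb R^d$ let $\widehat g(\xi)=\int_{\mathbb R^d}e^{-2\pi i x\cdot\xi}g(x)\,dx$, and for $f$ on $\mathbb Z^\kappa\times\mathbb R^d$ let $$\widehat f(\theta,\xi)=\sum_{n\in\mathbb Z^\kappa}e^{-2\pi i n\cdot\theta}\int_{\mathbb R^d}e^{-2\pi i x\cdot\xi}f(n,x)\,dx .$$ Let $$\mathbf B_{q,d}=\sup_{A}\ \sup_{|g|\le 1_A}\frac{\|\widehat g\|_{L^q(\mathbb R^d)}}{|A|^{1/p}},$$ where the suprema are over Lebesgue measurable sets $A\subset\mathbb R^d$ with $0<|A|<\infty$ and measurable $g:\mathbb R^d\to\mathbb C$ with $|g|\le 1_A$. Then there is a function $\rho$ (depending only on $d,\kappa,q$) with $\rho(\delta)\to0$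 as $\delta\to0^+$ such that the following holds for every $\delta\in(0,1)$. Let $E\subset\mathbb Z^\kappa\times\mathbb R^d$ be Lebesgue measurable with $|E|<\infty$, and let $0\ne f\in L^p(\mathbb Z^\kappa\times\mathbb R^d)$ satisfy $|f|\le 1_E$. If $$\|\widehat f\|_{L^q(\mathbb T^\kappa\times\mathbb R^d)}\ge(1-\delta)\,\mathbf B_{q,d}\,|E|^{1/p},$$ then there exists $m\in\mathbb Z^\kappa$ such that the slice $E_m=\{x\in\mathbb R^d:(m,x)\in E\}$ satisfies $$|E_m|\ge(1-\rho(\delta))\,|E|.$$ -/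

import Mathlib

open MeasureTheory Filter Topology
open scoped ENNReal FourierTransform

noncomputable section

/-- `f ≺ E`: the function `f` is measurable and `|f| ≤ 1_E` almost everywhere. -/
def MajorizedBy {X : Type*} [MeasurableSpace X] (μ : Measure X) (f : X → ℂ) (E : Set X) : Prop :=
  AEStronglyMeasurable f μ ∧ ∀ᵐ x ∂μ, ‖f x‖ ≤ E.indicator (fun _ => (1 : ℝ)) x

/-- `Ψ_q(E) = sup_{|f| ≤ 1_E} ‖f̂‖_q / ‖1_E‖_p` with `p = q'`, for `E ⊆ ℝ^d`. -/
def fourierPsi (q : ℝ) (d : ℕ) (E : Set (EuclideanSpace ℝ (Fin d))) : ℝ≥0∞ :=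
  ⨆ (f : EuclideanSpace ℝ (Fin d) → ℂ) (_ : MajorizedBy volume f E),
    eLpNorm (𝓕 f) (ENNReal.ofReal q) volume / (volume E) ^ (1 / q.conjExponent)

/-- `B_{q,d}`: the supremum of `Ψ_q(E)` over Lebesgue measurable `E ⊆ ℝ^d` with `0 < |E| < ∞`. -/
def fourierB (q : ℝ) (d : ℕ) : ℝ≥0∞ :=
  ⨆ (E : Set (EuclideanSpace ℝ (Fin d))) (_ : NullMeasurableSet E volume)
    (_ : 0 < volume E) (_ : volume E < ∞), fourierPsi q d E

/-- The group `ℤ^κ × ℝ^d`. -/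
abbrev LiftedSpace (κ d : ℕ) : Type := (Fin κ → ℤ) × EuclideanSpace ℝ (Fin d)

/-- Lebesgue measure on `ℤ^κ × ℝ^d`: counting measure times Lebesgue measure. -/
def liftedMeasure (κ d : ℕ) : Measure (LiftedSpace κ d) :=
  (Measure.count : Measure (Fin κ → ℤ)).prod (volume : Measure (EuclideanSpace ℝ (Fin d)))

/-- The measure on the dual group `𝕋^κ × ℝ^d`: normalized Haar measure times Lebesgue measure. -/
def dualMeasure (κ d : ℕ) : Measure (UnitAddTorus (Fin κ) × EuclideanSpace ℝ (Fin d)) :=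
  (Measure.pi fun _ : Fin κ => (AddCircle.haarAddCircle : Measure UnitAddCircle)).prod
    (volume : Measure (EuclideanSpace ℝ (Fin d)))

/-- The Fourier transform on `ℤ^κ × ℝ^d`,
`f̂(θ, ξ) = ∑_n e^{-2πi n·θ} ∫ e^{-2πi x·ξ} f(n, x) dx`. -/
def liftedFourier {κ d : ℕ} (f : LiftedSpace κ d → ℂ) :
    UnitAddTorus (Fin κ) × EuclideanSpace ℝ (Fin d) → ℂ :=
  fun z => ∑' n : Fin κ → ℤ, UnitAddTorus.mFourier (-n) z.1 * 𝓕 (fun x => f (n, x)) z.2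

/-- The slice `E_m = {x : (m, x) ∈ E}`. -/
def slice {κ d : ℕ} (E : Set (LiftedSpace κ d)) (m : Fin κ → ℤ) :
    Set (EuclideanSpace ℝ (Fin d)) :=
  {x | (m, x) ∈ E}

end

/-! For fixed `ξ`, the function `θ ↦ f̂(θ, ξ)` is a character series on the torus whose coefficients
`aₙ(ξ)` are the Fourier transforms of the slices of `f`. Plain Hausdorff–Young in `θ`, followed by
the definition of `fourierB` in each slice, already gives `‖f̂‖_q ≤ B |E|^{1/p}`. Concentration on
one slice comes from a quantitative improvement of the torus inequality when no single coefficient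
carries almost all of `∑ |aₙ|^p`.

That improvement comes from interpolation. The three lines theorem uses an `L¹`–`ℓ¹` bound on `Re z
= 0` and a Cauchy–Schwarz and Parseval bound on `Re z = 1`; a uniform gain on either line is a gain
in the result. If both bounds are nearly attained, the density `W² = |F|^q / ∫ |F|^q` lives where
one trigonometric polynomial has nearly maximal modulus, while `W` is `L²`-close to the modulus of
another, with coefficients `bₙ`. Two near-maximum points differ by some `t` with `|∑ |bₙ|² eₙ(t)|`
close to 1. As the torus is connected and no `|bₙ|²` dominates, this modulus takes a value just
below that threshold. Translation by such a `t` moves the near-maximum set off itself, so `W` and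
its translate overlap little; yet the polynomial with coefficients `bₙ` is strongly correlated with
its translate. `not_near_maximal` is this contradiction. Connectedness matters: on a finite group a
point mass, with all coefficients equal, is an extremizer.

A dominant coefficient makes `‖a‖_p^q` comparable to `‖a‖_q^q`, so `hausdorffYoung_mixed` holds in
all cases: `‖F‖_q^q ≤ (1 - η) ‖a‖_p^q + η C ‖a‖_q^q`. Integration in `ξ`
(`MajorizedBy.lintegral_liftedFourier_le`) turns the two terms into `B^q |E|^{q-1}` and `B^q ∑
|Eₙ|^{q-1}`. If every slice is below `t |E|`, the last sum is at most `t^{q-2} |E|^{q-1}`, which is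
incompatible with near-extremality once `C t^{q-2} < 1` and `δ` is small. -/

set_option linter.unusedSectionVars false

/-! ### Nearly parallel unit vectors. -/

section InnerProduct

variable {E : Type*} [NormedAddCommGroup E] [InnerProductSpace ℂ E]

/-- Two unit vectors which are both nearly parallel to a third one are nearly parallel. -/
lemma one_sub_four_mul_le_norm_inner {u v w : E} (hu : ‖u‖ = 1) (hv : ‖v‖ = 1) (hw : ‖w‖ = 1)
    {ε : ℝ} (h₁ : 1 - ε ≤ ‖inner ℂ w u‖) (h₂ : 1 - ε ≤ ‖inner ℂ w v‖) :
    1 - 4 * ε ≤ ‖inner ℂ u v‖ := by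
  have hww : inner ℂ w w = (1 : ℂ) := by rw [inner_self_eq_norm_sq_to_K, hw]; simp
  have key : ∀ u' : E, ‖u'‖ = 1 → 1 - ε ≤ ‖inner ℂ w u'‖ →
      ‖u' - inner ℂ w u' • w‖ ^ 2 ≤ 2 * ε := by
    intro u' hu' h
    have h0 : ‖u' - inner ℂ w u' • w‖ ^ 2 = 1 - ‖inner ℂ w u'‖ ^ 2 := by
      rw [@norm_sub_sq ℂ, inner_smul_right, norm_smul, hw, hu', ← inner_conj_symm u' w,
        RCLike.mul_conj]
      norm_cast
      norm_num
      ring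
    have h1 : ‖inner ℂ w u'‖ ≤ 1 := by
      simpa [hw, hu'] using norm_inner_le_norm (𝕜 := ℂ) w u'
    rw [h0]
    nlinarith
  have hr := key u hu h₁
  have hr' := key v hv h₂
  -- Split along `w`: the components orthogonal to `w` have squared norm at most `2ε`, so the loss
  -- is controlled by `(1 - ε)² - 2ε ≥ 1 - 4ε`.
  have hdec : inner ℂ u v = (starRingEnd ℂ) (inner ℂ w u) * inner ℂ w v +
      inner ℂ (u - inner ℂ w u • w) (v - inner ℂ w v • w) := by
    simp only [inner_sub_left, inner_sub_right, inner_smul_left, inner_smul_right, hww,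
      ← inner_conj_symm u w]
    ring
  have hin := norm_inner_le_norm (𝕜 := ℂ) (u - inner ℂ w u • w) (v - inner ℂ w v • w)
  have hle : ‖u - inner ℂ w u • w‖ * ‖v - inner ℂ w v • w‖ ≤ 2 * ε := by
    nlinarith [sq_nonneg (‖u - inner ℂ w u • w‖ - ‖v - inner ℂ w v • w‖)]
  have htri : ‖inner ℂ w u‖ * ‖inner ℂ w v‖ -
      ‖inner ℂ (u - inner ℂ w u • w) (v - inner ℂ w v • w)‖ ≤ ‖inner ℂ u v‖ := by
    rw [hdec]
    refine le_trans (le_of_eq ?_) (norm_sub_le_norm_add _ _)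
    simp only [norm_mul, RCLike.norm_conj]
  rcases le_or_gt ε 1 with h | h
  · have : (1 - ε) * (1 - ε) ≤ ‖inner ℂ w u‖ * ‖inner ℂ w v‖ :=
      mul_le_mul h₁ h₂ (by linarith) (norm_nonneg _)
    nlinarith
  · nlinarith [norm_nonneg (inner ℂ u v)]

end InnerProduct

/-! ### Orthonormal characters and translation of trigonometric polynomials. -/

/-- A finite or infinite orthonormal family of continuous characters of a group. -/
structure IsCharacterSystem {ι T : Type*} [AddCommGroup T] [TopologicalSpace T]
    [MeasurableSpace T] (μ : Measure T) (e : ι → T → ℂ) : Prop where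
  continuous : ∀ n, Continuous (e n)
  norm_eq_one : ∀ n x, ‖e n x‖ = 1
  map_add : ∀ n x y, e n (x + y) = e n x * e n y
  integral_self : ∀ n, ∫ x, (starRingEnd ℂ) (e n x) * e n x ∂μ = 1
  integral_ne : ∀ m n, m ≠ n → ∫ x, (starRingEnd ℂ) (e m x) * e n x ∂μ = 0

lemma IsCharacterSystem.comp_injective {ι σ T : Type*} [AddCommGroup T] [TopologicalSpace T]
    [MeasurableSpace T] {μ : Measure T} {e : ι → T → ℂ} (he : IsCharacterSystem μ e) {g : σ → ι}
    (hg : Function.Injective g) : IsCharacterSystem μ (fun n => e (g n)) where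
  continuous _ := he.continuous _
  norm_eq_one _ := he.norm_eq_one _
  map_add _ := he.map_add _
  integral_self _ := he.integral_self _
  integral_ne _ _ h := he.integral_ne _ _ (hg.ne h)

lemma Continuous.integrable_of_compactSpace {T E : Type*} [TopologicalSpace T] [CompactSpace T]
    [MeasurableSpace T] [BorelSpace T] [NormedAddCommGroup E] {μ : Measure T} [IsFiniteMeasure μ]
    {f : T → E} (hf : Continuous f) : Integrable f μ :=
  hf.integrable_of_hasCompactSupport (HasCompactSupport.of_compactSpace f)

namespace IsCharacterSystem

variable {ι T : Type*} [Fintype ι] [AddCommGroup T] [TopologicalSpace T] [IsTopologicalAddGroup T]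
  [CompactSpace T] [MeasurableSpace T] [BorelSpace T]
  {μ : Measure T} [IsProbabilityMeasure μ] {e : ι → T → ℂ}

lemma map_zero (he : IsCharacterSystem μ e) (n : ι) : e n 0 = 1 := by
  have h := he.map_add n 0 0
  have h0 : e n 0 ≠ 0 := by
    intro h0
    simpa [h0] using he.norm_eq_one n 0
  rw [add_zero] at h
  exact (mul_left_cancel₀ h0 (by rw [← h, mul_one])).symm

lemma conj_mul_self (he : IsCharacterSystem μ e) (n : ι) (x : T) :
    (starRingEnd ℂ) (e n x) * e n x = 1 := by
  rw [RCLike.conj_mul, he.norm_eq_one]; simp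

lemma continuous_sum (he : IsCharacterSystem μ e) (b : ι → ℂ) :
    Continuous fun x => ∑ n, b n * e n x :=
  continuous_finsetSum _ fun n _ => continuous_const.mul (he.continuous n)

lemma integral_conj_mul (he : IsCharacterSystem μ e) (b c : ι → ℂ) :
    ∫ x, (starRingEnd ℂ) (∑ n, b n * e n x) * ∑ n, c n * e n x ∂μ =
      ∑ n, (starRingEnd ℂ) (b n) * c n := by
  classical
  have hcont : ∀ m n, Continuous fun x => (starRingEnd ℂ) (e m x) * e n x := fun m n =>
    (Complex.continuous_conj.comp (he.continuous m)).mul (he.continuous n)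
  have h1 : ∀ x, (starRingEnd ℂ) (∑ n, b n * e n x) * ∑ n, c n * e n x =
      ∑ m, ∑ n, ((starRingEnd ℂ) (b m) * c n) * ((starRingEnd ℂ) (e m x) * e n x) := by
    intro x
    rw [map_sum, Finset.sum_mul_sum]
    refine Finset.sum_congr rfl fun m _ => Finset.sum_congr rfl fun n _ => ?_
    rw [map_mul]; ring
  simp_rw [h1]
  rw [integral_finsetSum _ fun m _ => integrable_finsetSum _ fun n _ =>
    ((hcont m n).integrable_of_compactSpace).const_mul _]
  refine Finset.sum_congr rfl fun m _ => ?_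
  rw [integral_finsetSum _ fun n _ => ((hcont m n).integrable_of_compactSpace).const_mul _]
  simp_rw [integral_const_mul]
  rw [Finset.sum_eq_single m]
  · rw [he.integral_self, mul_one]
  · intro n _ hn
    rw [he.integral_ne m n hn.symm, mul_zero]
  · simp

lemma integral_norm_sq (he : IsCharacterSystem μ e) (b : ι → ℂ) :
    ∫ x, ‖∑ n, b n * e n x‖ ^ 2 ∂μ = ∑ n, ‖b n‖ ^ 2 := by
  have h := he.integral_conj_mul b b
  simp_rw [RCLike.conj_mul] at h
  exact_mod_cast h

/-- The correlation of a trigonometric polynomial with its translates. -/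
lemma norm_sum_le_integral_mul_translate (he : IsCharacterSystem μ e) (b : ι → ℂ) (t : T) :
    ‖∑ n, (‖b n‖ ^ 2 : ℂ) * e n t‖ ≤
      ∫ x, ‖∑ n, b n * e n x‖ * ‖∑ n, b n * e n (x + t)‖ ∂μ := by
  have h := he.integral_conj_mul b (fun n => b n * e n t)
  have h2 : ∀ x, ∑ n, b n * e n t * e n x = ∑ n, b n * e n (x + t) := fun x =>
    Finset.sum_congr rfl fun n _ => by rw [he.map_add]; ring
  simp_rw [h2] at h
  have h3 : ∑ n, (starRingEnd ℂ) (b n) * (b n * e n t) = ∑ n, (‖b n‖ ^ 2 : ℂ) * e n t :=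
    Finset.sum_congr rfl fun n _ => by rw [← mul_assoc, RCLike.conj_mul]; rfl
  rw [← h3, ← h]
  refine (norm_integral_le_integral_norm _).trans (le_of_eq ?_)
  simp only [norm_mul, RCLike.norm_conj]

/-- If two points nearly maximize a trigonometric polynomial, then their difference is a near
maximum point of the polynomial with coefficients replaced by their moduli. -/
lemma one_sub_four_mul_le_norm_sum (he : IsCharacterSystem μ e) {a b : ι → ℂ}
    (hab : ∀ n, ‖a n‖ = ‖b n‖ ^ 2) (hb : ∑ n, ‖b n‖ ^ 2 = 1) {ε : ℝ} {x t : T}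
    (h₁ : 1 - ε ≤ ‖∑ n, a n * e n x‖) (h₂ : 1 - ε ≤ ‖∑ n, a n * e n (x + t)‖) :
    1 - 4 * ε ≤ ‖∑ n, (‖b n‖ ^ 2 : ℂ) * e n t‖ := by
  let v : T → EuclideanSpace ℂ ι := fun x => WithLp.toLp 2 fun n => (‖b n‖ : ℂ) * e n x
  -- The value at `x` becomes an inner product of the unit vectors `w` and `v x`; `w` is a unit
  -- vector because `|aₙ| = |bₙ|²`. Where `bₙ = 0` the division by zero gives the harmless entry 0.
  let w : EuclideanSpace ℂ ι := WithLp.toLp 2 fun n => (starRingEnd ℂ) (a n) / (‖b n‖ : ℂ)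
  have hv : ∀ x, ‖v x‖ = 1 := by
    intro x
    rw [EuclideanSpace.norm_eq]
    simp [v, he.norm_eq_one, hb]
  have hw : ‖w‖ = 1 := by
    rw [EuclideanSpace.norm_eq, Real.sqrt_eq_one, ← hb]
    refine Finset.sum_congr rfl fun n _ => ?_
    by_cases h : b n = 0
    · simp [w, h]
    · have : ‖b n‖ ≠ 0 := norm_ne_zero_iff.2 h
      simp only [w, norm_div, RCLike.norm_conj, Complex.norm_real, norm_norm, hab]
      field_simp
  have hin : ∀ x, inner ℂ w (v x) = ∑ n, a n * e n x := by
    intro x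
    rw [PiLp.inner_apply]
    refine Finset.sum_congr rfl fun n _ => ?_
    by_cases h : b n = 0
    · have : a n = 0 := by rw [← norm_eq_zero, hab, h]; simp
      simp [w, v, h, this]
    · have : (‖b n‖ : ℂ) ≠ 0 := by simpa using h
      simp only [w, v, RCLike.inner_apply, map_div₀, Complex.conj_conj, Complex.conj_ofReal]
      field_simp
  have hvv : inner ℂ (v x) (v (x + t)) = ∑ n, (‖b n‖ ^ 2 : ℂ) * e n t := by
    rw [PiLp.inner_apply]
    refine Finset.sum_congr rfl fun n _ => ?_
    simp only [v, RCLike.inner_apply, map_mul, Complex.conj_ofReal, he.map_add]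
    linear_combination (‖b n‖ ^ 2 : ℂ) * e n t * he.conj_mul_self n x
  rw [← hvv]
  exact one_sub_four_mul_le_norm_inner (hv _) (hv _) hw (by rwa [hin]) (by rwa [hin])

end IsCharacterSystem

/-! ### Near-extremizers on a connected group. -/

namespace IsCharacterSystem

variable {ι T : Type*} [Fintype ι] [AddCommGroup T] [TopologicalSpace T] [IsTopologicalAddGroup T]
  [CompactSpace T] [MeasurableSpace T] [BorelSpace T]
  {μ : Measure T} [IsProbabilityMeasure μ] {e : ι → T → ℂ}

/-- On a connected group, a positive definite trigonometric polynomial without dominant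
coefficient takes every modulus slightly below its maximum. -/
lemma exists_norm_sum_eq [PreconnectedSpace T] (he : IsCharacterSystem μ e) {b : ι → ℂ}
    (hb : ∑ n, ‖b n‖ ^ 2 = 1) {s : ℝ} (hs : 0 ≤ s) (hs1 : s ≤ 1)
    (hmax : ∀ n, ‖b n‖ ^ 2 ≤ s ^ 2) :
    ∃ t, ‖∑ n, (‖b n‖ ^ 2 : ℂ) * e n t‖ = s := by
  have hcont : Continuous fun t => ‖∑ n, (‖b n‖ ^ 2 : ℂ) * e n t‖ :=
    (he.continuous_sum _).norm
  have h0 : ‖∑ n, (‖b n‖ ^ 2 : ℂ) * e n 0‖ = 1 := by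
    simp_rw [he.map_zero, mul_one]
    have : (∑ n, (‖b n‖ ^ 2 : ℂ)) = ((∑ n, ‖b n‖ ^ 2 : ℝ) : ℂ) := by push_cast; rfl
    rw [this, hb]; simp
  by_contra! hne
  have hgt : ∀ t, s < ‖∑ n, (‖b n‖ ^ 2 : ℂ) * e n t‖ := by
    intro t
    by_contra! hle
    obtain ⟨t', ht'⟩ := mem_range_of_exists_le_of_exists_ge hcont ⟨t, hle⟩ ⟨0, h0 ▸ hs1⟩
    exact hne t' ht'
  -- A modulus everywhere above `s` would have mean square above `s²`, but by Parseval the mean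
  -- square is `∑ |bₙ|⁴ ≤ s²`.
  have hpars := he.integral_norm_sq fun n => (‖b n‖ ^ 2 : ℂ)
  have hle : ∑ n, ‖(‖b n‖ ^ 2 : ℂ)‖ ^ 2 ≤ s ^ 2 := by
    calc ∑ n, ‖(‖b n‖ ^ 2 : ℂ)‖ ^ 2 = ∑ n, ‖b n‖ ^ 2 * ‖b n‖ ^ 2 := by
          refine Finset.sum_congr rfl fun n _ => ?_
          rw [norm_pow, Complex.norm_real, norm_norm]; ring
      _ ≤ ∑ n, s ^ 2 * ‖b n‖ ^ 2 :=
          Finset.sum_le_sum fun n _ => mul_le_mul_of_nonneg_right (hmax n) (by positivity)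
      _ = s ^ 2 := by rw [← Finset.mul_sum, hb, mul_one]
  rw [← hpars] at hle
  obtain ⟨t₀, -, ht₀⟩ := isCompact_univ.exists_isMinOn (Set.univ_nonempty (α := T))
    hcont.continuousOn
  have hmin : ‖∑ n, (‖b n‖ ^ 2 : ℂ) * e n t₀‖ ^ 2 ≤
      ∫ x, ‖∑ n, (‖b n‖ ^ 2 : ℂ) * e n x‖ ^ 2 ∂μ := by
    have hc : ∫ _ : T, ‖∑ n, (‖b n‖ ^ 2 : ℂ) * e n t₀‖ ^ 2 ∂μ =
      ‖∑ n, (‖b n‖ ^ 2 : ℂ) * e n t₀‖ ^ 2 := by simp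
    rw [← hc]
    refine integral_mono (integrable_const _) (hcont.pow 2).integrable_of_compactSpace fun x => ?_
    exact pow_le_pow_left₀ (norm_nonneg _) (ht₀ (Set.mem_univ x)) 2
  nlinarith [hgt t₀]

/-- Let `a`, `b` have `|a| = |b|²` of mass one and no dominant entry. Then a square density `W²`
cannot be concentrated where `∑ aₙ eₙ` has nearly maximal modulus and at the same time be close
to the density of `∑ bₙ eₙ`. -/
lemma not_near_maximal [PreconnectedSpace T] [μ.IsAddRightInvariant] (he : IsCharacterSystem μ e)
    {a b : ι → ℂ}
    (hab : ∀ n, ‖a n‖ = ‖b n‖ ^ 2) (hb : ∑ n, ‖b n‖ ^ 2 = 1) {ε : ℝ} (hε : 0 < ε)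
    (hε1 : ε ≤ 1 / 100) (hmax : ∀ n, ‖b n‖ ^ 2 ≤ 1 - 10 * ε) {W : T → ℝ} (hW : Continuous W)
    (hW1 : ∫ x, W x ^ 2 ∂μ = 1)
    (h₀ : 1 - ε / 100 < ∫ x, W x ^ 2 * ‖∑ n, a n * e n x‖ ∂μ)
    (h₁ : 1 - 1 / 60 < ∫ x, W x * ‖∑ n, b n * e n x‖ ∂μ) : False := by
  -- The value `1 - 9ε/2` lies below the threshold `1 - 4ε` for differences of near-maximum points,
  -- while its square still exceeds `1 - 10ε`.
  obtain ⟨t, ht⟩ := he.exists_norm_sum_eq hb (s := 1 - 9 / 2 * ε) (by linarith) (by linarith)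
    fun n => (hmax n).trans (by nlinarith)
  set D : T → ℝ := fun x => ‖∑ n, a n * e n x‖ with hD
  set h : T → ℝ := fun x => ‖∑ n, b n * e n x‖ with hh
  have hDc : Continuous D := (he.continuous_sum a).norm
  have hhc : Continuous h := (he.continuous_sum b).norm
  have hD1 : ∀ x, D x ≤ 1 := by
    intro x
    refine (norm_sum_le _ _).trans (le_of_eq ?_)
    rw [← hb]
    exact Finset.sum_congr rfl fun n _ => by rw [norm_mul, he.norm_eq_one, mul_one, hab]
  have hadd : Continuous fun x : T => x + t := continuous_id.add continuous_const
  have hWt : Continuous fun x => W (x + t) := hW.comp hadd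
  have hDt : Continuous fun x => D (x + t) := hDc.comp hadd
  have hht : Continuous fun x => h (x + t) := hhc.comp hadd
  have hdich : ∀ x, ε ≤ 2 * (1 - D x) ∨ ε ≤ 2 * (1 - D (x + t)) := by
    intro x
    by_contra! hcon
    have := he.one_sub_four_mul_le_norm_sum hab hb (ε := ε) (x := x) (t := t)
      (by simp only [hD] at hcon; linarith [hcon.1]) (by simp only [hD] at hcon; linarith [hcon.2])
    linarith
  -- At one of the two points `1 - D` is at least `ε / 2`. The weighted inequality `uv ≤ u² + v²/4`
  -- puts the large weight on that point, where the defect term absorbs it.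
  have hpt : ∀ x, ε * (W x * W (x + t)) ≤ ε / 4 * (W x ^ 2 + W (x + t) ^ 2) +
      2 * (W x ^ 2 * (1 - D x) + W (x + t) ^ 2 * (1 - D (x + t))) := by
    intro x
    have hA : 0 ≤ W x ^ 2 * (1 - D x) := mul_nonneg (sq_nonneg _) (by linarith [hD1 x])
    have hB : 0 ≤ W (x + t) ^ 2 * (1 - D (x + t)) :=
      mul_nonneg (sq_nonneg _) (by linarith [hD1 (x + t)])
    rcases hdich x with hx | hx
    · have := mul_le_mul_of_nonneg_left hx (sq_nonneg (W x))
      have := mul_nonneg hε.le (sq_nonneg (W x - W (x + t) / 2))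
      nlinarith [mul_nonneg hε.le (sq_nonneg (W x))]
    · have := mul_le_mul_of_nonneg_left hx (sq_nonneg (W (x + t)))
      have := mul_nonneg hε.le (sq_nonneg (W (x + t) - W x / 2))
      nlinarith [mul_nonneg hε.le (sq_nonneg (W (x + t)))]
  have hW2t : ∫ x, W (x + t) ^ 2 ∂μ = 1 := by
    rw [← hW1]; exact integral_add_right_eq_self (fun x => W x ^ 2) t
  have hdef : ∫ x, W x ^ 2 * (1 - D x) ∂μ ≤ ε / 100 := by
    have : ∫ x, W x ^ 2 * (1 - D x) ∂μ = ∫ x, W x ^ 2 ∂μ - ∫ x, W x ^ 2 * D x ∂μ := by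
      rw [← integral_sub (by fun_prop : Continuous _).integrable_of_compactSpace
        (by fun_prop : Continuous _).integrable_of_compactSpace]
      simp_rw [mul_sub, mul_one]
    linarith
  have hdeft : ∫ x, W (x + t) ^ 2 * (1 - D (x + t)) ∂μ ≤ ε / 100 := by
    rw [integral_add_right_eq_self (fun x => W x ^ 2 * (1 - D x)) t]; exact hdef
  have hup : ε * ∫ x, W x * W (x + t) ∂μ ≤ ε / 4 * 2 + 2 * (ε / 100 + ε / 100) := by
    rw [← integral_const_mul]
    refine (integral_mono (by fun_prop : Continuous _).integrable_of_compactSpace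
      (by fun_prop : Continuous _).integrable_of_compactSpace hpt).trans ?_
    rw [integral_add (by fun_prop : Continuous _).integrable_of_compactSpace
        (by fun_prop : Continuous _).integrable_of_compactSpace,
      integral_const_mul, integral_const_mul,
      integral_add (by fun_prop : Continuous _).integrable_of_compactSpace
        (by fun_prop : Continuous _).integrable_of_compactSpace,
      integral_add (by fun_prop : Continuous _).integrable_of_compactSpace
        (by fun_prop : Continuous _).integrable_of_compactSpace, hW1, hW2t]
    linarith
  have hcorr := he.norm_sum_le_integral_mul_translate b t
  rw [ht] at hcorr
  change _ ≤ ∫ x, h x * h (x + t) ∂μ at hcorr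
  have hh1 : ∫ x, h x ^ 2 ∂μ = 1 := by rw [← hb]; exact he.integral_norm_sq b
  have hh1t : ∫ x, h (x + t) ^ 2 ∂μ = 1 := by
    rw [← hh1]; exact integral_add_right_eq_self (fun x => h x ^ 2) t
  have h₁t : 1 - 1 / 60 < ∫ x, W (x + t) * h (x + t) ∂μ := by
    rw [integral_add_right_eq_self (fun x => W x * h x) t]; exact h₁
  have hexp : ∀ {u v : T → ℝ}, Continuous u → Continuous v → ∫ x, u x ^ 2 ∂μ = 1 →
      ∫ x, v x ^ 2 ∂μ = 1 → ∫ x, (u x - v x) ^ 2 ∂μ = 2 - 2 * ∫ x, u x * v x ∂μ := by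
    intro u v hu hv hu1 hv1
    have : ∀ x, (u x - v x) ^ 2 = u x ^ 2 + v x ^ 2 - 2 * (u x * v x) := fun x => by ring
    simp_rw [this]
    rw [integral_sub (by fun_prop : Continuous _).integrable_of_compactSpace
        (by fun_prop : Continuous _).integrable_of_compactSpace,
      integral_add (by fun_prop : Continuous _).integrable_of_compactSpace
        (by fun_prop : Continuous _).integrable_of_compactSpace, integral_const_mul, hu1, hv1]
    ring
  -- Triangle inequality in `L²` along `W`, `h`, translated `h`, translated `W`, using `(u + v + w)²
  -- ≤ 3(u² + v² + w²)`. It forces an overlap above `0.76`, against the upper bound `0.54` from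
  -- `hup`.
  have hlow : 2 - 2 * ∫ x, W x * W (x + t) ∂μ ≤ 3 * ((2 - 2 * ∫ x, W x * h x ∂μ) +
      (2 - 2 * ∫ x, h x * h (x + t) ∂μ) + (2 - 2 * ∫ x, W (x + t) * h (x + t) ∂μ)) := by
    rw [← hexp hW hWt hW1 hW2t, ← hexp hW hhc hW1 hh1, ← hexp hhc hht hh1 hh1t,
      ← hexp hWt hht hW2t hh1t,
      ← integral_add (by fun_prop : Continuous _).integrable_of_compactSpace
        (by fun_prop : Continuous _).integrable_of_compactSpace,
      ← integral_add (by fun_prop : Continuous _).integrable_of_compactSpace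
        (by fun_prop : Continuous _).integrable_of_compactSpace, ← integral_const_mul]
    refine integral_mono (by fun_prop : Continuous _).integrable_of_compactSpace
        (by fun_prop : Continuous _).integrable_of_compactSpace fun x => ?_
    nlinarith [sq_nonneg ((W x - h x) - (h x - h (x + t))),
      sq_nonneg ((W x - h x) + (W (x + t) - h (x + t))),
      sq_nonneg ((h x - h (x + t)) + (W (x + t) - h (x + t)))]
  have hup' : ∫ x, W x * W (x + t) ∂μ ≤ 1 / 2 + 1 / 25 :=
    le_of_mul_le_mul_left (hup.trans (le_of_eq (by ring))) hε
  linarith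

end IsCharacterSystem

/-! ### Complex powers and the three lines theorem. -/

/-- The power `w ↦ sgn(w) |w|^s` used in complex interpolation. -/
noncomputable def Complex.signedPow (w s : ℂ) : ℂ := w / ‖w‖ * (‖w‖ : ℂ) ^ s

namespace Complex

lemma signedPow_zero_left (s : ℂ) : signedPow 0 s = 0 := by simp [signedPow]

lemma signedPow_one (w : ℂ) : signedPow w 1 = w := by
  by_cases h : w = 0
  · simp [h, signedPow_zero_left]
  · have : (‖w‖ : ℂ) ≠ 0 := by simpa using h
    rw [signedPow, cpow_one]
    field_simp

lemma norm_signedPow (w : ℂ) {s : ℂ} (hs : 0 < s.re) : ‖signedPow w s‖ = ‖w‖ ^ s.re := by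
  by_cases h : w = 0
  · simp [h, signedPow_zero_left, Real.zero_rpow hs.ne']
  · have h' : 0 < ‖w‖ := norm_pos_iff.2 h
    rw [signedPow, norm_mul, norm_cpow_eq_rpow_re_of_pos h', norm_div, Complex.norm_real,
      norm_norm, div_self h'.ne', one_mul]

lemma hasDerivAt_signedPow (w s : ℂ) :
    HasDerivAt (signedPow w) (signedPow w s * log ‖w‖) s := by
  by_cases h : w = 0
  · subst h
    have : signedPow 0 = fun _ => 0 := funext signedPow_zero_left
    simpa [this] using hasDerivAt_const s (0 : ℂ)
  · have h' : (‖w‖ : ℂ) ≠ 0 := by simpa using h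
    have := ((hasDerivAt_id s).const_cpow (Or.inl h')).const_mul (w / ‖w‖)
    convert! this using 1
    simp [signedPow, mul_assoc]

lemma differentiable_signedPow (w : ℂ) : Differentiable ℂ (signedPow w) := fun s =>
  (hasDerivAt_signedPow w s).differentiableAt

lemma measurable_signedPow (s : ℂ) : Measurable fun w => signedPow w s := by
  unfold signedPow
  fun_prop

lemma conj_signedPow_mul_self (w : ℂ) {q : ℝ} (hq : 1 < q) :
    signedPow ((starRingEnd ℂ) w) (q - 1 : ℝ) * w = ((‖w‖ ^ q : ℝ) : ℂ) := by
  by_cases h : w = 0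
  · simp [h, Real.zero_rpow (by linarith : q ≠ 0)]
  · have h' : 0 < ‖w‖ := norm_pos_iff.2 h
    have h'' : (‖w‖ : ℂ) ≠ 0 := by simpa using h
    rw [signedPow, RCLike.norm_conj, ← ofReal_cpow h'.le, Real.rpow_sub_one h'.ne']
    push_cast
    have := conj_mul' w
    field_simp
    linear_combination ((‖w‖ ^ q : ℝ) : ℂ) * this

lemma norm_signedPow_le {w s : ℂ} {M σ : ℝ} (hs : 0 < s.re) (hσ : s.re ≤ σ) (hM : ‖w‖ ≤ M) :
    ‖signedPow w s‖ ≤ (1 + M) ^ σ := by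
  rw [norm_signedPow w hs]
  have hM0 := (norm_nonneg w).trans hM
  calc ‖w‖ ^ s.re ≤ (1 + M) ^ s.re :=
        Real.rpow_le_rpow (norm_nonneg _) (by linarith) hs.le
    _ ≤ (1 + M) ^ σ := Real.rpow_le_rpow_of_exponent_le (by linarith) hσ

end Complex

-- Differentiation under the integral, which makes the interpolating function holomorphic. The
-- derivative contains `log ‖g x‖`, unbounded near zeros of `g`; Cauchy's estimate bounds it by the
-- values of the power itself.
open Complex in
lemma differentiableAt_integral_signedPow {T : Type*} [MeasurableSpace T] {μ : Measure T}
    [IsFiniteMeasure μ] {g c : T → ℂ} (hg : Measurable g) (hc : Measurable c) {M : ℝ}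
    (hgM : ∀ x, ‖g x‖ ≤ M) (hc1 : ∀ x, ‖c x‖ ≤ 1) {s₀ : ℂ} (hs₀ : 0 < s₀.re) :
    DifferentiableAt ℂ (fun s => ∫ x, signedPow (g x) s * c x ∂μ) s₀ := by
  -- Circles of radius `R` around points within `R` of `s₀` stay in the right half-plane, where the
  -- powers are bounded.
  set R := s₀.re / 4 with hR
  have hR0 : 0 < R := by positivity
  have hre : ∀ z, dist z s₀ ≤ 2 * R → 0 < z.re ∧ z.re ≤ 2 * s₀.re := by
    intro z hz
    rw [dist_eq_norm] at hz
    have := (abs_re_le_norm (z - s₀)).trans hz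
    rw [sub_re, abs_le] at this
    exact ⟨by linarith, by linarith⟩
  have hmeas : ∀ s, Measurable fun x => signedPow (g x) s * c x := fun s =>
    ((measurable_signedPow s).comp hg).mul hc
  refine (hasDerivAt_integral_of_dominated_loc_of_deriv_le (μ := μ)
    (F := fun s x => signedPow (g x) s * c x)
    (F' := fun s x => signedPow (g x) s * log ‖g x‖ * c x)
    (bound := fun _ => (1 + M) ^ (2 * s₀.re) / R) (Metric.ball_mem_nhds s₀ hR0)
    (.of_forall fun s => (hmeas s).aestronglyMeasurable) ?_ ?_ ?_ (integrable_const _)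
    ?_).2.differentiableAt
  · refine (integrable_const ((1 + M) ^ (2 * s₀.re))).mono' (hmeas s₀).aestronglyMeasurable
      (.of_forall fun x => ?_)
    rw [norm_mul]
    refine (mul_le_of_le_one_right (norm_nonneg _) (hc1 x)).trans ?_
    exact norm_signedPow_le hs₀ (by linarith) (hgM x)
  · refine Measurable.aestronglyMeasurable ?_
    refine (((measurable_signedPow s₀).comp hg).mul ?_).mul hc
    exact measurable_log.comp (measurable_ofReal.comp hg.norm)
  · refine .of_forall fun x s hs => ?_
    rw [norm_mul]
    refine (mul_le_of_le_one_right (norm_nonneg _) (hc1 x)).trans ?_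
    rw [← (hasDerivAt_signedPow (g x) s).deriv]
    refine norm_deriv_le_of_forall_mem_sphere_norm_le hR0
      (differentiable_signedPow _).diffContOnCl fun z hz => ?_
    have hz2 := hre z ((dist_triangle z s s₀).trans
      (by rw [Metric.mem_sphere] at hz; rw [Metric.mem_ball] at hs; linarith))
    exact norm_signedPow_le hz2.1 hz2.2 (hgM x)
  · exact .of_forall fun x s _ => (hasDerivAt_signedPow (g x) s).mul_const (c x)

namespace IsCharacterSystem

variable {ι T : Type*} [Fintype ι] [AddCommGroup T] [TopologicalSpace T] [IsTopologicalAddGroup T]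
  [CompactSpace T] [MeasurableSpace T] [BorelSpace T]
  {μ : Measure T} [IsProbabilityMeasure μ] {e : ι → T → ℂ}

open Complex in
/-- Complex interpolation for trigonometric polynomials, with the bounds on the two boundary lines
left as hypotheses. -/
lemma integral_norm_rpow_le_of_lines (he : IsCharacterSystem μ e) (a : ι → ℂ) {q : ℝ} (hq : 2 < q)
    {M₀ M₁ : ℝ}
    (h₀ : ∀ z : ℂ, z.re = 0 → ∫ x, ‖∑ n, a n * e n x‖ ^ q *
      ‖∑ n, signedPow (a n) ((q / (q - 1) : ℝ) * (1 - z / 2)) * e n x‖ ∂μ ≤ M₀)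
    (h₁ : ∀ z : ℂ, z.re = 1 → ∫ x, ‖∑ n, a n * e n x‖ ^ (q / 2) *
      ‖∑ n, signedPow (a n) ((q / (q - 1) : ℝ) * (1 - z / 2)) * e n x‖ ∂μ ≤ M₁) :
    ∫ x, ‖∑ n, a n * e n x‖ ^ q ∂μ ≤ M₀ ^ (1 - 2 / q) * M₁ ^ (2 / q) := by
  set p : ℝ := q / (q - 1) with hp
  have hq0 : 0 < q := by linarith
  have hp0 : 0 < p := div_pos hq0 (by linarith)
  set F : T → ℂ := fun x => ∑ n, a n * e n x with hF
  have hFc : Continuous F := he.continuous_sum a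
  set M : ℝ := ∑ n, ‖a n‖ with hM
  have hFM : ∀ x, ‖F x‖ ≤ M := fun x => (norm_sum_le _ _).trans
    (le_of_eq (Finset.sum_congr rfl fun n _ => by rw [norm_mul, he.norm_eq_one, mul_one]))
  have haM : ∀ n, ‖a n‖ ≤ M := fun n =>
    Finset.single_le_sum (f := fun n => ‖a n‖) (fun _ _ => norm_nonneg _) (Finset.mem_univ n)
  set g : T → ℂ := fun x => (starRingEnd ℂ) (F x) with hg
  have hgc : Continuous g := continuous_conj.comp hFc
  have hgn : ∀ x, ‖g x‖ = ‖F x‖ := fun x => RCLike.norm_conj _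
  have hgM : ∀ x, ‖g x‖ ≤ M := fun x => (hgn x).trans_le (hFM x)
  set A : ℂ → T → ℂ := fun z x => ∑ n, signedPow (a n) (p * (1 - z / 2)) * e n x with hA
  -- At `z = 2/q` the exponents are `q - 1` and `1`, so `Φ` equals `∫ |F|^q`; their real parts are
  -- `q, p` on the left line and `q/2, p/2` on the right one.
  set Φ : ℂ → ℂ := fun z => ∫ x, signedPow (g x) (q * (1 - z / 2)) * A z x ∂μ with hΦ
  have hre : ∀ (u : ℝ) (z : ℂ), ((u : ℂ) * (1 - z / 2)).re = u * (1 - z.re / 2) := by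
    intro u z
    rw [re_ofReal_mul]
    simp
  have hgmeas : ∀ s, AEStronglyMeasurable (fun x => signedPow (g x) s) μ := fun s =>
    ((measurable_signedPow s).comp hgc.measurable).aestronglyMeasurable
  have hgint : ∀ s : ℂ, 0 < s.re → Integrable (fun x => signedPow (g x) s) μ := fun s hs =>
    (integrable_const ((1 + M) ^ s.re)).mono' (hgmeas s)
      (.of_forall fun x => norm_signedPow_le hs le_rfl (hgM x))
  have hΦle : ∀ z : ℂ, z.re < 2 →
      ‖Φ z‖ ≤ ∫ x, ‖F x‖ ^ (q * (1 - z.re / 2)) * ‖A z x‖ ∂μ := by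
    intro z hz
    refine (norm_integral_le_integral_norm _).trans (le_of_eq (integral_congr_ae
      (.of_forall fun x => ?_)))
    have : 0 < ((q : ℂ) * (1 - z / 2)).re := by
      rw [hre]; exact mul_pos hq0 (by linarith)
    simp only [norm_mul]
    rw [norm_signedPow _ this, hre, hgn]
  have hΦd : ∀ z : ℂ, z.re < 2 → DifferentiableAt ℂ Φ z := by
    intro z₀ hz₀
    have hpos : ∀ u : ℝ, 0 < u → ∀ z : ℂ, z.re < 2 → 0 < ((u : ℂ) * (1 - z / 2)).re := by
      intro u hu z hz
      rw [hre]; exact mul_pos hu (by linarith)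
    have heq : Φ =ᶠ[𝓝 z₀] fun z => ∑ n, signedPow (a n) (p * (1 - z / 2)) *
        ∫ x, signedPow (g x) (q * (1 - z / 2)) * e n x ∂μ := by
      have hopen : {z : ℂ | z.re < 2} ∈ 𝓝 z₀ :=
        (isOpen_lt continuous_re continuous_const).mem_nhds hz₀
      filter_upwards [hopen] with z hz
      simp only [hΦ, hA, Finset.mul_sum]
      rw [integral_finsetSum]
      · refine Finset.sum_congr rfl fun n _ => ?_
        rw [← integral_const_mul]
        exact integral_congr_ae (.of_forall fun x => by ring)
      · intro n _
        refine (hgint _ (hpos q hq0 z hz)).mul_bdd (c := ‖signedPow (a n) (p * (1 - z / 2))‖) ?_ ?_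
        · exact (continuous_const.mul (he.continuous n)).aestronglyMeasurable
        · exact .of_forall fun x => by rw [norm_mul, he.norm_eq_one, mul_one]
    refine DifferentiableAt.congr_of_eventuallyEq ?_ heq
    have hlin : ∀ u : ℝ, DifferentiableAt ℂ (fun z : ℂ => (u : ℂ) * (1 - z / 2)) z₀ := fun u => by
      fun_prop
    refine DifferentiableAt.fun_sum fun n _ => DifferentiableAt.mul ?_ ?_
    · exact (differentiable_signedPow (a n) _).comp z₀ (hlin p)
    · have hd := differentiableAt_integral_signedPow (μ := μ) hgc.measurable
        (he.continuous n).measurable hgM (fun x => (he.norm_eq_one n x).le) (hpos q hq0 z₀ hz₀)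
      exact DifferentiableAt.comp (g := fun s => ∫ x, signedPow (g x) s * e n x ∂μ) z₀ hd (hlin q)
  have hclos : ∀ z ∈ closure (HadamardThreeLines.verticalStrip 0 1), z.re < 2 := by
    intro z hz
    have : z ∈ HadamardThreeLines.verticalClosedStrip 0 1 := by
      refine closure_minimal ?_ (isClosed_Icc.preimage continuous_re) hz
      exact Set.preimage_mono Set.Ioo_subset_Icc_self
    linarith [this.2]
  have hbdd : BddAbove ((norm ∘ Φ) '' HadamardThreeLines.verticalClosedStrip 0 1) := by
    refine ⟨(1 + M) ^ q * ∑ n : ι, (1 + M) ^ p, ?_⟩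
    rintro _ ⟨z, hz, rfl⟩
    have hz0 : 0 ≤ z.re := hz.1
    have hz1 : z.re ≤ 1 := hz.2
    refine (norm_integral_le_of_norm_le_const (C := (1 + M) ^ q * ∑ n : ι, (1 + M) ^ p)
      (.of_forall fun x => ?_)).trans (by simp)
    have hM0 : 0 ≤ M := Finset.sum_nonneg fun _ _ => norm_nonneg _
    rw [norm_mul]
    refine mul_le_mul ?_ ?_ (norm_nonneg _) (by positivity)
    · refine norm_signedPow_le ?_ ?_ (hgM x) <;> rw [hre] <;> nlinarith
    · refine (norm_sum_le _ _).trans (Finset.sum_le_sum fun n _ => ?_)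
      rw [norm_mul, he.norm_eq_one, mul_one]
      refine norm_signedPow_le ?_ ?_ (haM n) <;> rw [hre] <;> nlinarith
  have hθ : ((2 / q : ℝ) : ℂ) ∈ HadamardThreeLines.verticalClosedStrip 0 1 :=
    ⟨by rw [ofReal_re]; positivity, by rw [ofReal_re, div_le_one hq0]; exact hq.le⟩
  have hmain := HadamardThreeLines.norm_le_interp_of_mem_verticalClosedStrip₀₁' Φ
    (a := M₀) (b := M₁) hθ
    (DifferentiableOn.diffContOnCl fun z hz => (hΦd z (hclos z hz)).differentiableWithinAt)
    hbdd ?_ ?_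
  · rw [ofReal_re] at hmain
    refine le_trans (le_of_eq ?_) hmain
    have e1 : (q : ℂ) * (1 - ((2 / q : ℝ) : ℂ) / 2) = ((q - 1 : ℝ) : ℂ) := by
      have : (q : ℂ) ≠ 0 := by exact_mod_cast hq0.ne'
      push_cast; field_simp
    have e2 : (p : ℂ) * (1 - ((2 / q : ℝ) : ℂ) / 2) = 1 := by
      have h1 : (q : ℂ) ≠ 0 := by exact_mod_cast hq0.ne'
      have h2 : (q : ℂ) - 1 ≠ 0 := by
        exact_mod_cast (by linarith : q - 1 ≠ 0)
      rw [hp]; push_cast; field_simp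
    have e3 : Φ ((2 / q : ℝ) : ℂ) = ((∫ x, ‖F x‖ ^ q ∂μ : ℝ) : ℂ) := by
      rw [← integral_complex_ofReal]
      refine integral_congr_ae (.of_forall fun x => ?_)
      simp only [hA]
      rw [e1, e2]
      simp only [signedPow_one]
      exact conj_signedPow_mul_self (F x) (by linarith)
    rw [e3, norm_real, Real.norm_of_nonneg]
    exact integral_nonneg fun x => by positivity
  · intro z hz
    have hz' : z.re = 0 := hz
    refine (hΦle z (by linarith)).trans (le_trans (le_of_eq ?_) (h₀ z hz'))
    simp [hz', hF, hA]
  · intro z hz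
    have hz' : z.re = 1 := hz
    refine (hΦle z (by linarith)).trans (le_trans (le_of_eq ?_) (h₁ z hz'))
    have : q * (1 - 1 / 2) = q / 2 := by ring
    simp only [hz', hF, hA, this]

end IsCharacterSystem

/-! ### Hausdorff–Young with a gain. -/

/-- The gain in the Hausdorff--Young inequality for coefficients without dominant entry. -/
noncomputable def hausdorffYoungGap (q ε : ℝ) : ℝ :=
  1 - max ((1 - ε / 100) ^ (q - 2)) ((59 / 60) ^ 2)

lemma hausdorffYoungGap_pos {q ε : ℝ} (hq : 2 < q) (hε : 0 < ε) (hε1 : ε ≤ 1 / 100) :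
    0 < hausdorffYoungGap q ε := by
  have : (1 - ε / 100) ^ (q - 2) < 1 :=
    Real.rpow_lt_one (by linarith) (by linarith) (by linarith)
  rw [hausdorffYoungGap, sub_pos, max_lt_iff]
  exact ⟨this, by norm_num⟩

lemma hausdorffYoungGap_lt_one (q ε : ℝ) : hausdorffYoungGap q ε < 1 := by
  have : (0 : ℝ) < (59 / 60) ^ 2 := by norm_num
  have := this.trans_le (le_max_right ((1 - ε / 100) ^ (q - 2)) _)
  rw [hausdorffYoungGap]
  linarith

/-- The right side contains `J` to the power `1 - 1/q`, so `J` can be cancelled and the rest raised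
to the power `q`. Factors `m₀`, `m₁` gained on the boundary lines survive as `m₀^{q-2} m₁²`. -/
lemma le_of_le_interpolated {q J S m₀ m₁ : ℝ} (hq : 2 < q) (hJ : 0 ≤ J) (hS : 0 ≤ S)
    (hm₀ : 0 ≤ m₀) (hm₁ : 0 ≤ m₁)
    (h : J ≤ (m₀ * (J * S)) ^ (1 - 2 / q) * (m₁ * (J ^ (1 / 2 : ℝ) * S ^ (1 / 2 : ℝ))) ^ (2 / q)) :
    J ≤ m₀ ^ (q - 2) * m₁ ^ 2 * S ^ (q - 1) := by
  rcases hJ.eq_or_lt with rfl | hJ'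
  · positivity
  rcases hS.eq_or_lt with rfl | hS'
  · rw [mul_zero, mul_zero, Real.zero_rpow, zero_mul] at h
    · linarith
    · have : 2 / q < 1 := by rw [div_lt_one (by linarith)]; exact hq
      linarith
  have hq0 : 0 < q := by linarith
  have h1 : (m₀ * (J * S)) ^ (1 - 2 / q) * (m₁ * (J ^ (1 / 2 : ℝ) * S ^ (1 / 2 : ℝ))) ^ (2 / q) =
      m₀ ^ (1 - 2 / q) * m₁ ^ (2 / q) * S ^ (1 - 1 / q) * J ^ (1 - 1 / q) := by
    rw [Real.mul_rpow hm₀ (by positivity), Real.mul_rpow hJ hS, Real.mul_rpow hm₁ (by positivity),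
      Real.mul_rpow (by positivity) (by positivity), ← Real.rpow_mul hJ, ← Real.rpow_mul hS]
    have e : (1 : ℝ) - 1 / q = (1 - 2 / q) + 1 / 2 * (2 / q) := by field_simp; ring
    rw [e, Real.rpow_add hJ', Real.rpow_add hS']
    ring
  rw [h1] at h
  have h2 : J ^ (1 / q) ≤ m₀ ^ (1 - 2 / q) * m₁ ^ (2 / q) * S ^ (1 - 1 / q) := by
    refine le_of_mul_le_mul_right ?_ (Real.rpow_pos_of_pos hJ' (1 - 1 / q))
    rw [← Real.rpow_add hJ']
    simpa using h
  have h3 := Real.rpow_le_rpow (by positivity) h2 hq0.le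
  rw [← Real.rpow_mul hJ, Real.mul_rpow (by positivity) (by positivity),
    Real.mul_rpow (by positivity) (by positivity), ← Real.rpow_mul hm₀, ← Real.rpow_mul hm₁,
    ← Real.rpow_mul hS] at h3
  have e1 : 1 / q * q = 1 := by field_simp
  have e2 : (1 - 2 / q) * q = q - 2 := by field_simp
  have e3 : 2 / q * q = (2 : ℕ) := by push_cast; field_simp
  have e4 : (1 - 1 / q) * q = q - 1 := by field_simp
  rwa [e1, e2, e3, e4, Real.rpow_one, Real.rpow_natCast] at h3

namespace IsCharacterSystem

variable {ι T : Type*} [Fintype ι] [AddCommGroup T] [TopologicalSpace T] [IsTopologicalAddGroup T]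
  [CompactSpace T] [MeasurableSpace T] [BorelSpace T]
  {μ : Measure T} [IsProbabilityMeasure μ] {e : ι → T → ℂ}

open Complex

lemma norm_signedPow_of_re_eq_zero (w : ℂ) {p : ℝ} (hp : 0 < p) {z : ℂ} (hz : z.re = 0) :
    ‖signedPow w (p * (1 - z / 2))‖ = ‖w‖ ^ p := by
  have : ((p : ℂ) * (1 - z / 2)).re = p := by rw [re_ofReal_mul]; simp [hz]
  rw [norm_signedPow _ (by rwa [this]), this]

lemma norm_signedPow_sq_of_re_eq_one (w : ℂ) {p : ℝ} (hp : 0 < p) {z : ℂ} (hz : z.re = 1) :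
    ‖signedPow w (p * (1 - z / 2))‖ ^ 2 = ‖w‖ ^ p := by
  have : ((p : ℂ) * (1 - z / 2)).re = p / 2 := by rw [re_ofReal_mul]; simp [hz]; ring
  rw [norm_signedPow _ (by rw [this]; linarith), this, ← Real.rpow_natCast,
    ← Real.rpow_mul (norm_nonneg _)]
  congr 1
  push_cast; ring

/-- Only the triangle inequality is used, so near-equality means that the second polynomial has
nearly maximal modulus on most of the mass of `|F|^q`. -/
lemma integral_mul_norm_sum_le_of_re_eq_zero (he : IsCharacterSystem μ e) (a : ι → ℂ) {p q : ℝ}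
    (hp : 0 < p) (hq : 0 < q) {z : ℂ} (hz : z.re = 0) :
    ∫ x, ‖∑ n, a n * e n x‖ ^ q * ‖∑ n, signedPow (a n) (p * (1 - z / 2)) * e n x‖ ∂μ ≤
      (∫ x, ‖∑ n, a n * e n x‖ ^ q ∂μ) * ∑ n, ‖a n‖ ^ p := by
  have hF : Continuous fun x => ‖∑ n, a n * e n x‖ ^ q :=
    (he.continuous_sum a).norm.rpow_const fun _ => Or.inr hq.le
  rw [← integral_mul_const]
  refine integral_mono (hF.mul (he.continuous_sum _).norm).integrable_of_compactSpace
    (hF.mul continuous_const).integrable_of_compactSpace fun x => ?_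
  refine mul_le_mul_of_nonneg_left ((norm_sum_le _ _).trans (le_of_eq ?_)) (by positivity)
  refine Finset.sum_congr rfl fun n _ => ?_
  rw [norm_mul, he.norm_eq_one, mul_one, norm_signedPow_of_re_eq_zero _ hp hz]

/-- Cauchy–Schwarz and Parseval; near-equality means that the two normalized factors are `L²`-close.
-/
lemma integral_mul_norm_sum_le_of_re_eq_one (he : IsCharacterSystem μ e) (a : ι → ℂ) {p q : ℝ}
    (hp : 0 < p) (hq : 0 < q) {z : ℂ} (hz : z.re = 1) :
    ∫ x, ‖∑ n, a n * e n x‖ ^ (q / 2) * ‖∑ n, signedPow (a n) (p * (1 - z / 2)) * e n x‖ ∂μ ≤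
      (∫ x, ‖∑ n, a n * e n x‖ ^ q ∂μ) ^ (1 / 2 : ℝ) * (∑ n, ‖a n‖ ^ p) ^ (1 / 2 : ℝ) := by
  have hF : Continuous fun x => ‖∑ n, a n * e n x‖ ^ (q / 2) :=
    (he.continuous_sum a).norm.rpow_const fun _ => Or.inr (by positivity)
  have hG := (he.continuous_sum fun n => signedPow (a n) (p * (1 - z / 2))).norm
  have hmem : ∀ {u : T → ℝ}, Continuous u → MemLp u (ENNReal.ofReal 2) μ := by
    intro u hu
    obtain ⟨C, hC⟩ := isCompact_univ.exists_bound_of_continuousOn hu.continuousOn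
    exact MemLp.of_bound hu.integrable_of_compactSpace.aestronglyMeasurable C
      (.of_forall fun x => hC x (Set.mem_univ x))
  refine (integral_mul_le_Lp_mul_Lq_of_nonneg Real.HolderConjugate.two_two
    (.of_forall fun x => by positivity) (.of_forall fun x => by positivity)
    (hmem hF) (hmem hG)).trans (le_of_eq ?_)
  congr 2
  · refine integral_congr_ae (.of_forall fun x => ?_)
    simp only
    rw [← Real.rpow_mul (norm_nonneg _)]
    congr 1; ring
  · simp_rw [Real.rpow_two]
    rw [he.integral_norm_sq]
    exact Finset.sum_congr rfl fun n _ => norm_signedPow_sq_of_re_eq_one _ hp hz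

/-- The Hausdorff--Young inequality for trigonometric polynomials. -/
lemma hausdorffYoung (he : IsCharacterSystem μ e) (a : ι → ℂ) {q : ℝ} (hq : 2 < q) :
    ∫ x, ‖∑ n, a n * e n x‖ ^ q ∂μ ≤ (∑ n, ‖a n‖ ^ (q / (q - 1))) ^ (q - 1) := by
  have hp : 0 < q / (q - 1) := div_pos (by linarith) (by linarith)
  have := le_of_le_interpolated (m₀ := 1) (m₁ := 1) hq
    (integral_nonneg fun x => by positivity : 0 ≤ ∫ x, ‖∑ n, a n * e n x‖ ^ q ∂μ)
    (Finset.sum_nonneg fun n _ => by positivity : 0 ≤ ∑ n, ‖a n‖ ^ (q / (q - 1)))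
    zero_le_one zero_le_one
    (by
      rw [one_mul, one_mul]
      exact he.integral_norm_rpow_le_of_lines a hq
        (fun z hz => he.integral_mul_norm_sum_le_of_re_eq_zero a hp (by linarith) hz)
        (fun z hz => he.integral_mul_norm_sum_le_of_re_eq_one a hp (by linarith) hz))
  simpa using this

/-- The Hausdorff--Young inequality is strict, with a uniform gain, when no coefficient dominates
the others. -/
lemma hausdorffYoung_of_no_dominant [PreconnectedSpace T] [μ.IsAddRightInvariant]
    (he : IsCharacterSystem μ e) (a : ι → ℂ) {q ε : ℝ} (hq : 2 < q) (hε : 0 < ε)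
    (hε1 : ε ≤ 1 / 100)
    (hmax : ∀ n, ‖a n‖ ^ (q / (q - 1)) ≤ (1 - 10 * ε) * ∑ n, ‖a n‖ ^ (q / (q - 1))) :
    ∫ x, ‖∑ n, a n * e n x‖ ^ q ∂μ ≤
      (1 - hausdorffYoungGap q ε) * (∑ n, ‖a n‖ ^ (q / (q - 1))) ^ (q - 1) := by
  have hHY := he.hausdorffYoung a hq
  set p : ℝ := q / (q - 1) with hpdef
  have hq0 : 0 < q := by linarith
  have hp : 0 < p := div_pos hq0 (by linarith)
  set J := ∫ x, ‖∑ n, a n * e n x‖ ^ q ∂μ with hJ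
  set S := ∑ n, ‖a n‖ ^ p with hS
  have hJ0 : 0 ≤ J := integral_nonneg fun x => by positivity
  have hS0 : 0 ≤ S := Finset.sum_nonneg fun n _ => by positivity
  have hgap : 0 ≤ (1 - hausdorffYoungGap q ε) * S ^ (q - 1) :=
    mul_nonneg (by linarith [hausdorffYoungGap_lt_one q ε]) (by positivity)
  rcases hJ0.eq_or_lt with hJz | hJpos
  · rw [← hJz]; exact hgap
  rcases hS0.eq_or_lt with hSz | hSpos
  · rw [← hSz, Real.zero_rpow (by linarith)] at hHY
    linarith
  by_cases hc₀ : ∀ z : ℂ, z.re = 0 → ∫ x, ‖∑ n, a n * e n x‖ ^ q *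
      ‖∑ n, signedPow (a n) (p * (1 - z / 2)) * e n x‖ ∂μ ≤ (1 - ε / 100) * (J * S)
  · have := le_of_le_interpolated (m₀ := 1 - ε / 100) (m₁ := 1) hq hJ0 hS0 (by linarith)
      zero_le_one (by
        rw [one_mul]
        exact he.integral_norm_rpow_le_of_lines a hq hc₀
          (fun z hz => he.integral_mul_norm_sum_le_of_re_eq_one a hp hq0 hz))
    refine this.trans (mul_le_mul_of_nonneg_right ?_ (by positivity))
    rw [hausdorffYoungGap]
    simp
  by_cases hc₁ : ∀ z : ℂ, z.re = 1 → ∫ x, ‖∑ n, a n * e n x‖ ^ (q / 2) *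
      ‖∑ n, signedPow (a n) (p * (1 - z / 2)) * e n x‖ ∂μ ≤
        59 / 60 * (J ^ (1 / 2 : ℝ) * S ^ (1 / 2 : ℝ))
  · have := le_of_le_interpolated (m₀ := 1) (m₁ := 59 / 60) hq hJ0 hS0 zero_le_one
      (by norm_num) (by
        rw [one_mul]
        exact he.integral_norm_rpow_le_of_lines a hq
          (fun z hz => he.integral_mul_norm_sum_le_of_re_eq_zero a hp hq0 hz) hc₁)
    refine this.trans (mul_le_mul_of_nonneg_right ?_ (by positivity))
    rw [hausdorffYoungGap]
    simp
  -- Both bounds are nearly attained, but at unrelated heights `z₀` and `z₁`. The two polynomials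
  -- have different phases and share only the relation `|α| = |β|²` between normalized coefficients,
  -- which is all that `not_near_maximal` requires.
  exfalso
  push Not at hc₀ hc₁
  obtain ⟨z₀, hz₀, hlt₀⟩ := hc₀
  obtain ⟨z₁, hz₁, hlt₁⟩ := hc₁
  have hJh : 0 < J ^ (1 / 2 : ℝ) := by positivity
  have hSh : 0 < S ^ (1 / 2 : ℝ) := by positivity
  have hJsq : (J ^ (1 / 2 : ℝ)) ^ 2 = J := by
    rw [← Real.rpow_natCast, ← Real.rpow_mul hJ0]; norm_num
  have hSsq : (S ^ (1 / 2 : ℝ)) ^ 2 = S := by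
    rw [← Real.rpow_natCast, ← Real.rpow_mul hS0]; norm_num
  have hb : ∀ n, ‖signedPow (a n) (p * (1 - z₁ / 2)) / (S ^ (1 / 2 : ℝ) : ℝ)‖ ^ 2 =
      ‖a n‖ ^ p / S := by
    intro n
    rw [norm_div, div_pow, norm_signedPow_sq_of_re_eq_one _ hp hz₁, norm_real,
      Real.norm_of_nonneg hSh.le, hSsq]
  have ha : ∀ n, ‖signedPow (a n) (p * (1 - z₀ / 2)) / (S : ℂ)‖ = ‖a n‖ ^ p / S := by
    intro n
    rw [norm_div, norm_signedPow_of_re_eq_zero _ hp hz₀, norm_real, Real.norm_of_nonneg hS0]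
  have hWsq : ∀ x, (‖∑ n, a n * e n x‖ ^ (q / 2) / J ^ (1 / 2 : ℝ)) ^ 2 =
      ‖∑ n, a n * e n x‖ ^ q / J := by
    intro x
    rw [div_pow, hJsq, ← Real.rpow_natCast, ← Real.rpow_mul (norm_nonneg _)]
    congr 2; push_cast; ring
  have hdiv : ∀ (c : ι → ℂ) (s : ℝ) (x : T), 0 < s →
      ‖∑ n, c n / (s : ℂ) * e n x‖ = ‖∑ n, c n * e n x‖ / s := by
    intro c s x hs
    have : ∑ n, c n / (s : ℂ) * e n x = (∑ n, c n * e n x) / s := by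
      rw [Finset.sum_div]
      exact Finset.sum_congr rfl fun n _ => by ring
    rw [this, norm_div, norm_real, Real.norm_of_nonneg hs.le]
  refine he.not_near_maximal (a := fun n => signedPow (a n) (p * (1 - z₀ / 2)) / (S : ℂ))
    (b := fun n => signedPow (a n) (p * (1 - z₁ / 2)) / (S ^ (1 / 2 : ℝ) : ℝ))
    (W := fun x => ‖∑ n, a n * e n x‖ ^ (q / 2) / J ^ (1 / 2 : ℝ))
    (fun n => by rw [ha, hb]) ?_ hε hε1 ?_ ?_ ?_ ?_ ?_
  · simp_rw [hb]
    rw [← Finset.sum_div, div_self hSpos.ne']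
  · intro n
    rw [hb, div_le_iff₀ hSpos]
    exact hmax n
  · exact ((he.continuous_sum a).norm.rpow_const fun _ => Or.inr (by positivity)).div_const _
  · simp_rw [hWsq]
    rw [integral_div, div_self hJpos.ne']
  · simp_rw [hWsq, hdiv _ _ _ hSpos, div_mul_div_comm]
    rw [integral_div, lt_div_iff₀ (by positivity)]
    exact hlt₀
  · simp_rw [hdiv _ _ _ hSh, div_mul_div_comm]
    rw [integral_div, lt_div_iff₀ (by positivity)]
    norm_num at hlt₁ ⊢
    exact hlt₁

/-- A Hausdorff--Young inequality with the mixed right hand side `(1 - η) ‖a‖_p^q + C ‖a‖_q^q`. -/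
lemma hausdorffYoung_mixed [PreconnectedSpace T] [μ.IsAddRightInvariant]
    (he : IsCharacterSystem μ e) (a : ι → ℂ) {q ε : ℝ} (hq : 2 < q) (hε : 0 < ε)
    (hε1 : ε ≤ 1 / 100) :
    ∫ x, ‖∑ n, a n * e n x‖ ^ q ∂μ ≤
      (1 - hausdorffYoungGap q ε) * (∑ n, ‖a n‖ ^ (q / (q - 1))) ^ (q - 1) +
        hausdorffYoungGap q ε * ((1 - 10 * ε)⁻¹ ^ (q - 1) * ∑ n, ‖a n‖ ^ q) := by
  have hgap := hausdorffYoungGap_pos hq hε hε1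
  have hinv : 0 < 1 - 10 * ε := by linarith
  by_cases h : ∀ n, ‖a n‖ ^ (q / (q - 1)) ≤ (1 - 10 * ε) * ∑ n, ‖a n‖ ^ (q / (q - 1))
  · refine (he.hausdorffYoung_of_no_dominant a hq hε hε1 h).trans (le_add_of_nonneg_right ?_)
    positivity
  -- A dominant coefficient bounds `‖a‖_p^q` by a multiple of `‖a‖_q^q`; the result is then a convex
  -- combination, with weights `1 - η` and `η`, of this bound and plain Hausdorff–Young.
  · push Not at h
    obtain ⟨n, hn⟩ := h
    have h1 : (∑ n, ‖a n‖ ^ (q / (q - 1))) ^ (q - 1) ≤ (1 - 10 * ε)⁻¹ ^ (q - 1) * ‖a n‖ ^ q := by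
      have h2 : ∑ n, ‖a n‖ ^ (q / (q - 1)) ≤ (1 - 10 * ε)⁻¹ * ‖a n‖ ^ (q / (q - 1)) := by
        rw [inv_mul_eq_div, le_div_iff₀ hinv, mul_comm]
        exact hn.le
      refine (Real.rpow_le_rpow (by positivity) h2 (by linarith)).trans (le_of_eq ?_)
      rw [Real.mul_rpow (by positivity) (by positivity), ← Real.rpow_mul (norm_nonneg _),
        div_mul_cancel₀ _ (by linarith : q - 1 ≠ 0)]
    have h3 : ‖a n‖ ^ q ≤ ∑ n, ‖a n‖ ^ q :=
      Finset.single_le_sum (f := fun n => ‖a n‖ ^ q) (fun _ _ => by positivity)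
        (Finset.mem_univ n)
    have h4 := h1.trans (mul_le_mul_of_nonneg_left h3 (by positivity))
    have h5 := he.hausdorffYoung a hq
    nlinarith

end IsCharacterSystem

/-! ### Infinite character series and the torus. -/

namespace IsCharacterSystem

variable {ι T : Type*} [AddCommGroup T] [TopologicalSpace T] [IsTopologicalAddGroup T]
  [CompactSpace T] [MeasurableSpace T] [BorelSpace T]
  {μ : Measure T} [IsProbabilityMeasure μ] {e : ι → T → ℂ}

lemma lintegral_enorm_sum_rpow_le [PreconnectedSpace T] [μ.IsAddRightInvariant]
    (he : IsCharacterSystem μ e) (a : ι → ℂ) {q ε : ℝ} (hq : 2 < q) (hε : 0 < ε)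
    (hε1 : ε ≤ 1 / 100) (s : Finset ι) :
    ∫⁻ x, ‖∑ n ∈ s, e n x * a n‖ₑ ^ q ∂μ ≤
      ENNReal.ofReal (1 - hausdorffYoungGap q ε) *
          (∑ n ∈ s, ‖a n‖ₑ ^ (q / (q - 1))) ^ (q - 1) +
        ENNReal.ofReal (hausdorffYoungGap q ε * (1 - 10 * ε)⁻¹ ^ (q - 1)) *
          ∑ n ∈ s, ‖a n‖ₑ ^ q := by
  have hq0 : 0 < q := by linarith
  have hs := he.comp_injective (Subtype.val_injective (p := (· ∈ s)))
  have h := hs.hausdorffYoung_mixed (fun n => a n) hq hε hε1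
  have hgap := hausdorffYoungGap_pos hq hε hε1
  have hgap1 := hausdorffYoungGap_lt_one q ε
  have hinv : 0 < 1 - 10 * ε := by linarith
  have hp : 0 ≤ q / (q - 1) := div_nonneg hq0.le (by linarith)
  have hsum : ∀ r : ℝ, 0 ≤ r → ∑ n ∈ s, ‖a n‖ₑ ^ r = ENNReal.ofReal (∑ n : s, ‖a n‖ ^ r) := by
    intro r hr
    rw [Finset.sum_coe_sort s fun n => ‖a n‖ ^ r,
      ENNReal.ofReal_sum_of_nonneg fun _ _ => by positivity]
    refine Finset.sum_congr rfl fun n _ => ?_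
    rw [← ENNReal.ofReal_rpow_of_nonneg (norm_nonneg _) hr, ofReal_norm]
  rw [hsum q hq0.le, hsum _ hp, ENNReal.ofReal_rpow_of_nonneg (by positivity) (by linarith),
    ← ENNReal.ofReal_mul (by linarith), ← ENNReal.ofReal_mul (by positivity),
    ← ENNReal.ofReal_add (mul_nonneg (by linarith) (by positivity)) (by positivity)]
  refine le_trans (le_of_eq ?_) (ENNReal.ofReal_le_ofReal (h.trans (le_of_eq (by ring))))
  have hint : Integrable (fun x => ‖∑ n : s, a n * e n x‖ ^ q) μ :=
    ((hs.continuous_sum fun n => a n).norm.rpow_const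
      fun _ => Or.inr hq0.le).integrable_of_compactSpace
  rw [ofReal_integral_eq_lintegral_ofReal hint (.of_forall fun x => by positivity)]
  refine lintegral_congr fun x => ?_
  rw [← ENNReal.ofReal_rpow_of_nonneg (norm_nonneg _) hq0.le, ofReal_norm,
    Finset.sum_coe_sort s fun n => a n * e n x]
  simp_rw [mul_comm]

/-- The mixed Hausdorff--Young inequality for absolutely convergent character series. -/
lemma lintegral_enorm_tsum_rpow_le [Countable ι] [PreconnectedSpace T] [μ.IsAddRightInvariant]
    (he : IsCharacterSystem μ e) {a : ι → ℂ} (ha : Summable fun n => ‖a n‖) {q ε : ℝ}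
    (hq : 2 < q) (hε : 0 < ε) (hε1 : ε ≤ 1 / 100) :
    ∫⁻ x, ‖∑' n, e n x * a n‖ₑ ^ q ∂μ ≤
      ENNReal.ofReal (1 - hausdorffYoungGap q ε) *
          (∑' n, ‖a n‖ₑ ^ (q / (q - 1))) ^ (q - 1) +
        ENNReal.ofReal (hausdorffYoungGap q ε * (1 - 10 * ε)⁻¹ ^ (q - 1)) *
          ∑' n, ‖a n‖ₑ ^ q := by
  -- Countability of `ι` gives a sequence of finite sets, along which Fatou's lemma passes the
  -- finite inequality to the limit.
  obtain ⟨s, hs⟩ := exists_seq_tendsto (atTop : Filter (Finset ι))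
  have hlim : ∀ x, Tendsto (fun k => ‖∑ n ∈ s k, e n x * a n‖ₑ ^ q) atTop
      (𝓝 (‖∑' n, e n x * a n‖ₑ ^ q)) := by
    intro x
    have hsum : Summable fun n => e n x * a n :=
      Summable.of_norm (by simpa only [norm_mul, he.norm_eq_one, one_mul] using ha)
    exact ((ENNReal.continuous_rpow_const.comp continuous_enorm).tendsto _).comp
      (hsum.hasSum.comp hs)
  have hmeas : ∀ k, Measurable fun x => ‖∑ n ∈ s k, e n x * a n‖ₑ ^ q := by
    intro k
    have : Continuous fun x => ∑ n ∈ s k, e n x * a n :=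
      continuous_finsetSum _ fun n _ => (he.continuous n).mul continuous_const
    exact this.measurable.enorm.pow_const q
  calc ∫⁻ x, ‖∑' n, e n x * a n‖ₑ ^ q ∂μ
      = ∫⁻ x, liminf (fun k => ‖∑ n ∈ s k, e n x * a n‖ₑ ^ q) atTop ∂μ :=
        lintegral_congr fun x => (hlim x).liminf_eq.symm
    _ ≤ liminf (fun k => ∫⁻ x, ‖∑ n ∈ s k, e n x * a n‖ₑ ^ q ∂μ) atTop :=
        lintegral_liminf_le hmeas
    _ ≤ liminf (fun _ : ℕ => ENNReal.ofReal (1 - hausdorffYoungGap q ε) *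
          (∑' n, ‖a n‖ₑ ^ (q / (q - 1))) ^ (q - 1) +
        ENNReal.ofReal (hausdorffYoungGap q ε * (1 - 10 * ε)⁻¹ ^ (q - 1)) *
          ∑' n, ‖a n‖ₑ ^ q) atTop := by
        refine liminf_le_liminf (.of_forall fun k => ?_)
        refine (he.lintegral_enorm_sum_rpow_le a hq hε hε1 (s k)).trans ?_
        gcongr
        · linarith
        · exact ENNReal.sum_le_tsum _
        · exact ENNReal.sum_le_tsum _
    _ = _ := liminf_const _

end IsCharacterSystem

/-- The index `-n` matches the sign convention of `liftedFourier`; negation is injective, so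
orthonormality persists. -/
lemma isCharacterSystem_mFourier (κ : ℕ) :
    IsCharacterSystem (Measure.pi fun _ : Fin κ => (AddCircle.haarAddCircle : Measure UnitAddCircle))
      (fun (n : Fin κ → ℤ) (x : UnitAddTorus (Fin κ)) => UnitAddTorus.mFourier (-n) x) := by
  have key := orthonormal_iff_ite.1 (UnitAddTorus.orthonormal_mFourier (d := Fin κ))
  simp only [ContinuousMap.inner_toLp] at key
  refine ⟨fun n => (UnitAddTorus.mFourier (-n)).continuous, fun n x => ?_, fun n x y => ?_,
    fun n => ?_, fun m n h => ?_⟩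
  · simp [UnitAddTorus.mFourier, fourier_apply, Circle.norm_coe]
  · simp [UnitAddTorus.mFourier, fourier_apply, smul_add, AddCircle.toCircle_add,
      Finset.prod_mul_distrib]
  · have := key (-n) (-n)
    rw [if_pos rfl] at this
    refine Eq.trans ?_ this
    exact integral_congr_ae (.of_forall fun x => by simp [mul_comm])
  · have := key (-m) (-n)
    rw [if_neg (by simpa using h)] at this
    refine Eq.trans ?_ this
    exact integral_congr_ae (.of_forall fun x => by simp [mul_comm])

/-! ### Plancherel for the integral Fourier transform. -/

section Plancherel

variable {V : Type*} [NormedAddCommGroup V] [InnerProductSpace ℝ V] [FiniteDimensional ℝ V]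
  [MeasurableSpace V] [BorelSpace V]

lemma MeasureTheory.Integrable.continuous_fourier {f : V → ℂ} (hf : Integrable f) :
    Continuous (𝓕 f) :=
  VectorFourier.fourierIntegral_continuous Real.continuous_fourierChar
    (innerSL ℝ : V →L[ℝ] V →L[ℝ] ℝ).continuous₂ hf

lemma norm_fourier_le_integral_norm (f : V → ℂ) (ξ : V) : ‖𝓕 f ξ‖ ≤ ∫ x, ‖f x‖ :=
  VectorFourier.norm_fourierIntegral_le_integral_norm _ _ _ _ _

/-- On `L¹ ∩ L²`, the integral and the `L²` definitions of the Fourier transform agree. -/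
lemma fourier_toLp_ae_eq {f : V → ℂ} (hf : Integrable f) (hf2 : MemLp f 2) :
    𝓕 f =ᵐ[volume] (𝓕 (hf2.toLp f) : Lp ℂ 2 (volume : Measure V)) := by
  -- Against test functions, both transforms move onto the test function: by Fubini for the
  -- integral, by the distributional definition for the `L²` class.
  refine ae_eq_of_integral_contDiff_smul_eq hf.continuous_fourier.locallyIntegrable
    ((Lp.memLp _).locallyIntegrable one_le_two) fun g hg hgc => ?_
  have hg' : ContDiff ℝ (⊤ : ℕ∞) fun x => (g x : ℂ) := Complex.ofRealCLM.contDiff.comp hg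
  have hgc' : HasCompactSupport fun x => (g x : ℂ) := hgc.comp_left (g := Complex.ofReal) rfl
  set φ : SchwartzMap V ℂ := hgc'.toSchwartzMap hg' with hφ
  have hφg : ∀ x, φ x = (g x : ℂ) := fun x => rfl
  have h := congrArg (fun u : TemperedDistribution V ℂ => u φ)
    (Lp.fourier_toTemperedDistribution_eq (hf2.toLp f))
  simp only [TemperedDistribution.fourier_apply, Lp.toTemperedDistribution_apply] at h
  have hflip : ∫ x, f x • 𝓕 (φ : V → ℂ) x = ∫ ξ, 𝓕 f ξ • φ ξ := by
    have := VectorFourier.integral_fourierIntegral_smul_eq_flip (μ := (volume : Measure V))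
      (ν := (volume : Measure V)) (L := innerₗ V) Real.continuous_fourierChar
      (innerSL ℝ : V →L[ℝ] V →L[ℝ] ℝ).continuous₂ hf φ.integrable
    rw [flip_innerₗ] at this
    exact this.symm
  calc ∫ x, g x • 𝓕 f x = ∫ ξ, 𝓕 f ξ • φ ξ := by
        refine integral_congr_ae (.of_forall fun x => ?_)
        simp [hφg, mul_comm]
    _ = ∫ x, f x • 𝓕 (φ : V → ℂ) x := hflip.symm
    _ = ∫ x, (𝓕 φ) x • (hf2.toLp f) x := by
        refine integral_congr_ae ?_
        filter_upwards [hf2.coeFn_toLp] with x hx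
        rw [hx, SchwartzMap.fourier_coe, smul_eq_mul, smul_eq_mul, mul_comm]
    _ = _ := by
        rw [h]
        refine integral_congr_ae (.of_forall fun x => ?_)
        simp [hφg]

lemma eLpNorm_two_fourier {f : V → ℂ} (hf : Integrable f) (hf2 : MemLp f 2) :
    eLpNorm (𝓕 f) 2 volume = eLpNorm f 2 volume := by
  rw [eLpNorm_congr_ae (fourier_toLp_ae_eq hf hf2), ← Lp.enorm_def, ← ofReal_norm,
    Lp.norm_fourier_eq, ofReal_norm, Lp.enorm_toLp]

end Plancherel

/-! ### Functions dominated by an indicator. -/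

namespace MajorizedBy

variable {X : Type*} [MeasurableSpace X] {μ : Measure X} {f : X → ℂ} {E : Set X}

lemma enorm_le_indicator (h : MajorizedBy μ f E) :
    ∀ᵐ x ∂μ, ‖f x‖ₑ ≤ E.indicator 1 x := by
  filter_upwards [h.2] with x hx
  by_cases hxE : x ∈ E
  · simp only [Set.indicator_of_mem hxE, Pi.one_apply] at hx ⊢
    rw [← ofReal_norm]
    exact ENNReal.ofReal_le_one.2 hx
  · simp only [Set.indicator_of_notMem hxE] at hx ⊢
    rw [norm_le_zero_iff.1 hx]
    simp

lemma lintegral_enorm_rpow_le (h : MajorizedBy μ f E) {r : ℝ} (hr : 0 < r) :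
    ∫⁻ x, ‖f x‖ₑ ^ r ∂μ ≤ μ E := by
  refine (lintegral_mono_ae ?_).trans (lintegral_indicator_one_le E)
  filter_upwards [h.enorm_le_indicator] with x hx
  refine (ENNReal.rpow_le_rpow hx hr.le).trans ?_
  by_cases hxE : x ∈ E <;> simp [hxE, hr]

lemma lintegral_enorm_le (h : MajorizedBy μ f E) : ∫⁻ x, ‖f x‖ₑ ∂μ ≤ μ E := by
  simpa using h.lintegral_enorm_rpow_le one_pos

lemma integrable (h : MajorizedBy μ f E) (hE : μ E < ∞) : Integrable f μ :=
  ⟨h.1, h.lintegral_enorm_le.trans_lt hE⟩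

lemma integral_norm_le (h : MajorizedBy μ f E) (hE : μ E < ∞) :
    ∫ x, ‖f x‖ ∂μ ≤ (μ E).toReal := by
  rw [integral_norm_eq_lintegral_enorm h.1]
  exact ENNReal.toReal_mono hE.ne h.lintegral_enorm_le

lemma memLp_two (h : MajorizedBy μ f E) (hE : μ E < ∞) : MemLp f 2 μ := by
  refine ⟨h.1, ?_⟩
  rw [eLpNorm_lt_top_iff_lintegral_rpow_enorm_lt_top (by norm_num) (by norm_num)]
  exact (h.lintegral_enorm_rpow_le (by norm_num)).trans_lt hE

end MajorizedBy

/-! ### The Euclidean constant is positive and finite. -/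

section FourierB

variable {d : ℕ} {q : ℝ} {f : EuclideanSpace ℝ (Fin d) → ℂ} {A : Set (EuclideanSpace ℝ (Fin d))}

/-- Elementary interpolation between `‖f̂‖_∞ ≤ |A|` and Plancherel. The constant 1 suffices for
finiteness of `fourierB` and for null sets, which its supremum excludes. -/
lemma MajorizedBy.lintegral_enorm_fourier_rpow_le (h : MajorizedBy volume f A)
    (hA : volume A < ∞) (hq : 2 < q) : ∫⁻ ξ, ‖𝓕 f ξ‖ₑ ^ q ≤ volume A ^ (q - 1) := by
  have h2 : ∫⁻ ξ, ‖𝓕 f ξ‖ₑ ^ (2 : ℝ) ≤ volume A := by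
    have h3 := eLpNorm_two_fourier (h.integrable hA) (h.memLp_two hA)
    rw [eLpNorm_eq_lintegral_rpow_enorm_toReal (by norm_num) (by norm_num),
      eLpNorm_eq_lintegral_rpow_enorm_toReal (by norm_num) (by norm_num)] at h3
    have h4 := ENNReal.rpow_left_injective (by norm_num) h3
    simp only [ENNReal.toReal_ofNat] at h4
    rw [h4]
    exact h.lintegral_enorm_rpow_le two_pos
  have hsup : ∀ ξ, ‖𝓕 f ξ‖ₑ ≤ volume A := by
    intro ξ
    rw [← ofReal_norm, ENNReal.ofReal_le_iff_le_toReal hA.ne]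
    exact (norm_fourier_le_integral_norm f ξ).trans (h.integral_norm_le hA)
  calc ∫⁻ ξ, ‖𝓕 f ξ‖ₑ ^ q ≤ ∫⁻ ξ, volume A ^ (q - 2) * ‖𝓕 f ξ‖ₑ ^ (2 : ℝ) := by
        refine lintegral_mono fun ξ => ?_
        have e : q = (q - 2) + 2 := by ring
        conv_lhs => rw [e, ENNReal.rpow_add_of_nonneg _ _ (by linarith) (by norm_num)]
        gcongr
        exact hsup ξ
    _ = volume A ^ (q - 2) * ∫⁻ ξ, ‖𝓕 f ξ‖ₑ ^ (2 : ℝ) :=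
        lintegral_const_mul' _ _ (ENNReal.rpow_ne_top_of_nonneg (by linarith) hA.ne)
    _ ≤ volume A ^ (q - 2) * volume A ^ (1 : ℝ) := by rw [ENNReal.rpow_one]; gcongr
    _ = volume A ^ (q - 1) := by
        rw [← ENNReal.rpow_add_of_nonneg _ _ (by linarith) (by norm_num)]
        congr 1; ring

lemma eLpNorm_ofReal_eq {X : Type*} [MeasurableSpace X] {μ : Measure X} (g : X → ℂ) (hq : 0 < q) :
    eLpNorm g (ENNReal.ofReal q) μ = (∫⁻ x, ‖g x‖ₑ ^ q ∂μ) ^ (1 / q) := by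
  rw [eLpNorm_eq_lintegral_rpow_enorm_toReal (by simpa using hq) (by simp),
    ENNReal.toReal_ofReal hq.le]

lemma fourierB_le_one (hq : 2 < q) : fourierB q d ≤ 1 := by
  refine iSup_le fun A => iSup_le fun _ => iSup_le fun hA0 => iSup_le fun hA => ?_
  refine iSup_le fun f => iSup_le fun hf => ?_
  refine ENNReal.div_le_of_le_mul ?_
  rw [eLpNorm_ofReal_eq _ (by linarith), one_mul]
  refine (ENNReal.rpow_le_rpow (hf.lintegral_enorm_fourier_rpow_le hA hq)
    (by positivity)).trans (le_of_eq ?_)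
  rw [← ENNReal.rpow_mul, Real.conjExponent]
  congr 1
  have : q - 1 ≠ 0 := by linarith
  field_simp

lemma MajorizedBy.lintegral_enorm_fourier_rpow_le_fourierB (h : MajorizedBy volume f A)
    (hA : NullMeasurableSet A volume) (hAtop : volume A < ∞) (hq : 2 < q) :
    ∫⁻ ξ, ‖𝓕 f ξ‖ₑ ^ q ≤ fourierB q d ^ q * volume A ^ (q - 1) := by
  have hq0 : 0 < q := by linarith
  rcases eq_or_ne (volume A) 0 with h0 | h0
  · refine (h.lintegral_enorm_fourier_rpow_le hAtop hq).trans ?_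
    rw [h0, ENNReal.zero_rpow_of_pos (by linarith)]
    exact zero_le
  have hle : eLpNorm (𝓕 f) (ENNReal.ofReal q) volume / volume A ^ (1 / q.conjExponent) ≤
      fourierB q d :=
    le_iSup_of_le A <| le_iSup_of_le hA <| le_iSup_of_le (pos_iff_ne_zero.2 h0) <|
      le_iSup_of_le hAtop <| le_iSup_of_le f <| le_iSup_of_le h le_rfl
  rw [ENNReal.div_le_iff (by simp [h0, hAtop.ne]) (by simp [h0, hAtop.ne]),
    eLpNorm_ofReal_eq _ hq0] at hle
  have := ENNReal.rpow_le_rpow hle hq0.le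
  rw [← ENNReal.rpow_mul, ENNReal.mul_rpow_of_nonneg _ _ hq0.le, ← ENNReal.rpow_mul,
    Real.conjExponent] at this
  convert this using 2
  · rw [one_div, inv_mul_cancel₀ hq0.ne', ENNReal.rpow_one]
  · congr 1
    have : q - 1 ≠ 0 := by linarith
    field_simp

lemma fourierB_pos (hq : 2 < q) : 0 < fourierB q d := by
  have hq0 : 0 < q := by linarith
  by_contra! hB
  have hB0 : fourierB q d = 0 := le_antisymm hB zero_le
  set A : Set (EuclideanSpace ℝ (Fin d)) := Metric.ball 0 1
  set f : EuclideanSpace ℝ (Fin d) → ℂ := A.indicator 1 with hf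
  have hAm : MeasurableSet A := measurableSet_ball
  have hAtop : volume A < ∞ := measure_ball_lt_top
  have hApos : 0 < volume A := Metric.measure_ball_pos _ _ one_pos
  have hmaj : MajorizedBy volume f A := by
    refine ⟨(measurable_one.indicator hAm).aestronglyMeasurable, .of_forall fun x => ?_⟩
    by_cases hx : x ∈ A <;> simp [hf, hx]
  have h := hmaj.lintegral_enorm_fourier_rpow_le_fourierB hAm.nullMeasurableSet hAtop hq
  have hcont := (hmaj.integrable hAtop).continuous_fourier
  rw [hB0, ENNReal.zero_rpow_of_pos hq0, zero_mul, nonpos_iff_eq_zero,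
    lintegral_eq_zero_iff (hcont.measurable.enorm.pow_const q)] at h
  have hz : 𝓕 f =ᵐ[volume] 0 := by
    filter_upwards [h] with ξ hξ
    simpa [hq0, hq0.le, hq0.not_gt] using hξ
  -- Continuity upgrades almost everywhere vanishing to vanishing at 0, where the transform of the
  -- indicator is `|A| > 0`.
  have hz' := congrFun ((hcont.ae_eq_iff_eq volume continuous_zero).1 hz) 0
  have h0 : 𝓕 f 0 = ((volume A).toReal : ℂ) := by
    rw [Real.fourier_eq]
    simp [hf, integral_indicator hAm, Measure.real]
  rw [h0] at hz'
  simp [ENNReal.toReal_eq_zero_iff, hApos.ne', hAtop.ne] at hz'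

end FourierB

/-! ### Weighted Jensen, and tolerances tending to zero. -/

/-- A weighted Jensen inequality for sums in `[0, ∞]`. -/
lemma ENNReal.tsum_rpow_le_weighted {ι : Type*} (w x : ι → ℝ≥0∞) (hw : ∀ i, w i ≠ ∞)
    (hx : ∀ i, w i = 0 → x i = 0) {r : ℝ} (hr : 1 ≤ r) :
    (∑' i, x i) ^ r ≤ (∑' i, w i) ^ (r - 1) * ∑' i, w i * (x i / w i) ^ r := by
  have hr0 : 0 < r := by linarith
  have key : ∑' i, x i ≤
      ((∑' i, w i) ^ (r - 1) * ∑' i, w i * (x i / w i) ^ r) ^ r⁻¹ := by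
    rw [ENNReal.tsum_eq_iSup_sum]
    refine iSup_le fun s => ?_
    have h := ENNReal.inner_le_weight_mul_Lp_of_nonneg s hr w fun i => x i / w i
    have e : ∑ i ∈ s, w i * (x i / w i) = ∑ i ∈ s, x i := by
      refine Finset.sum_congr rfl fun i _ => ?_
      by_cases h0 : w i = 0
      · rw [h0, hx i h0, zero_mul]
      · exact ENNReal.mul_div_cancel h0 (hw i)
    rw [e] at h
    refine h.trans ?_
    rw [ENNReal.mul_rpow_of_nonneg _ _ (inv_nonneg.2 hr0.le), ← ENNReal.rpow_mul]
    have e2 : (r - 1) * r⁻¹ = 1 - r⁻¹ := by field_simp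
    have e3 : 0 ≤ 1 - r⁻¹ := by
      rw [sub_nonneg]; exact inv_le_one_of_one_le₀ hr
    rw [e2]
    gcongr <;> exact ENNReal.sum_le_tsum s
  calc (∑' i, x i) ^ r ≤ _ := ENNReal.rpow_le_rpow key hr0.le
    _ = _ := by rw [← ENNReal.rpow_mul, inv_mul_cancel₀ hr0.ne', ENNReal.rpow_one]

/-- A property holding for each positive tolerance at sufficiently small parameters holds with a
tolerance tending to zero. -/
lemma exists_tendsto_zero_of_eventually {P : ℝ → ℝ → Prop}
    (hmono : ∀ δ s t, s ≤ t → P δ s → P δ t) (hone : ∀ δ, P δ 1)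
    (hev : ∀ τ, 0 < τ → ∀ᶠ δ in 𝓝[>] (0 : ℝ), P δ τ) :
    ∃ ρ : ℝ → ℝ, Tendsto ρ (𝓝[>] 0) (𝓝 0) ∧ ∀ δ, 0 < δ → P δ (ρ δ) := by
  have hbdd : ∀ δ, BddBelow {τ | 0 ≤ τ ∧ P δ τ} := fun δ => ⟨0, fun τ h => h.1⟩
  have hne : ∀ δ, {τ | 0 ≤ τ ∧ P δ τ}.Nonempty := fun δ => ⟨1, zero_le_one, hone δ⟩
  -- The infimum need not be attained; adding `δ` leaves room for an admissible `τ` below.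
  refine ⟨fun δ => sInf {τ | 0 ≤ τ ∧ P δ τ} + δ, ?_, fun δ hδ => ?_⟩
  · have h1 : Tendsto (fun δ => sInf {τ | 0 ≤ τ ∧ P δ τ}) (𝓝[>] 0) (𝓝 0) := by
      refine tendsto_order.2 ⟨fun c hc => .of_forall fun δ => ?_, fun c hc => ?_⟩
      · exact hc.trans_le (le_csInf (hne δ) fun τ h => h.1)
      · filter_upwards [hev (c / 2) (by positivity)] with δ hδ
        exact (csInf_le (hbdd δ) ⟨by positivity, hδ⟩).trans_lt (by linarith)
    simpa using h1.add (tendsto_nhdsWithin_of_tendsto_nhds tendsto_id)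
  · obtain ⟨τ, hτ, hlt⟩ := exists_lt_of_csInf_lt (hne δ)
      (lt_add_of_pos_right (sInf {τ | 0 ≤ τ ∧ P δ τ}) hδ)
    exact hmono δ τ _ hlt.le hτ.2

/-! ### Slicing and integration over the Euclidean frequency. -/

section Lifted

variable {κ d : ℕ}

lemma ae_slice {P : LiftedSpace κ d → Prop} (h : ∀ᵐ z ∂liftedMeasure κ d, P z)
    (n : Fin κ → ℤ) : ∀ᵐ x : EuclideanSpace ℝ (Fin d), P (n, x) :=
  Measure.ae_count_iff.1 (Measure.ae_ae_of_ae_prod h) n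

lemma nullMeasurableSet_slice {E : Set (LiftedSpace κ d)}
    (hE : NullMeasurableSet E (liftedMeasure κ d)) (n : Fin κ → ℤ) :
    NullMeasurableSet (slice E n) volume := by
  obtain ⟨E', hE'm, hE'⟩ := hE
  exact ⟨slice E' n, measurable_prodMk_left hE'm, ae_slice hE' n⟩

lemma liftedMeasure_eq_tsum {E : Set (LiftedSpace κ d)}
    (hE : NullMeasurableSet E (liftedMeasure κ d)) :
    liftedMeasure κ d E = ∑' n, volume (slice E n) := by
  obtain ⟨E', hE'm, hE'⟩ := hE
  rw [measure_congr hE', liftedMeasure, Measure.prod_apply hE'm, lintegral_count]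
  exact tsum_congr fun n => (measure_congr (ae_slice hE' n)).symm

lemma MajorizedBy.section_slice {E : Set (LiftedSpace κ d)} {f : LiftedSpace κ d → ℂ}
    (h : MajorizedBy (liftedMeasure κ d) f E) (n : Fin κ → ℤ) :
    MajorizedBy volume (fun x => f (n, x)) (slice E n) :=
  ⟨Measure.ae_count_iff.1 h.1.prodMk_left n, ae_slice h.2 n⟩

/-- The upper bound for the Fourier transform on `ℤ^κ × ℝ^d` in terms of the measures of slices. -/
lemma MajorizedBy.lintegral_liftedFourier_le {q ε : ℝ} (hq : 2 < q) (hε : 0 < ε)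
    (hε1 : ε ≤ 1 / 100) {E : Set (LiftedSpace κ d)} {f : LiftedSpace κ d → ℂ}
    (hE : NullMeasurableSet E (liftedMeasure κ d)) (hEtop : liftedMeasure κ d E < ∞)
    (h : MajorizedBy (liftedMeasure κ d) f E) :
    ∫⁻ z, ‖liftedFourier f z‖ₑ ^ q ∂dualMeasure κ d ≤
      fourierB q d ^ q * (ENNReal.ofReal (1 - hausdorffYoungGap q ε) *
          liftedMeasure κ d E ^ (q - 1) +
        ENNReal.ofReal (hausdorffYoungGap q ε * (1 - 10 * ε)⁻¹ ^ (q - 1)) *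
          ∑' n, volume (slice E n) ^ (q - 1)) := by
  have hq0 : 0 < q := by linarith
  have hsum := liftedMeasure_eq_tsum hE
  set V : (Fin κ → ℤ) → ℝ≥0∞ := fun n => volume (slice E n) with hV
  have hVsum : ∑' n, V n ≠ ∞ := by rw [← hsum]; exact hEtop.ne
  have hVtop : ∀ n, V n < ∞ := fun n => (ENNReal.ne_top_of_tsum_ne_top hVsum n).lt_top
  set a : (Fin κ → ℤ) → EuclideanSpace ℝ (Fin d) → ℂ := fun n => 𝓕 fun x => f (n, x) with ha
  have hac : ∀ n, Continuous (a n) := fun n =>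
    ((h.section_slice n).integrable (hVtop n)).continuous_fourier
  have hale : ∀ n ξ, ‖a n ξ‖ ≤ (V n).toReal := fun n ξ =>
    (norm_fourier_le_integral_norm _ ξ).trans ((h.section_slice n).integral_norm_le (hVtop n))
  have hVs : Summable fun n => (V n).toReal := ENNReal.summable_toReal hVsum
  have haq : ∀ n, ∫⁻ ξ, ‖a n ξ‖ₑ ^ q ≤ fourierB q d ^ q * V n ^ (q - 1) := fun n =>
    (h.section_slice n).lintegral_enorm_fourier_rpow_le_fourierB (nullMeasurableSet_slice hE n)
      (hVtop n) hq
  have hcs := isCharacterSystem_mFourier κ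
  have hfc : Continuous (liftedFourier f) := by
    refine continuous_tsum (fun n => ?_) hVs fun n z => ?_
    · exact ((hcs.continuous n).comp continuous_fst).mul ((hac n).comp continuous_snd)
    · rw [norm_mul, hcs.norm_eq_one, one_mul]
      exact hale n z.2
  have hpt : ∀ ξ, ∫⁻ θ, ‖liftedFourier f (θ, ξ)‖ₑ ^ q
        ∂(Measure.pi fun _ : Fin κ => (AddCircle.haarAddCircle : Measure UnitAddCircle)) ≤
      ENNReal.ofReal (1 - hausdorffYoungGap q ε) *
          (∑' n, ‖a n ξ‖ₑ ^ (q / (q - 1))) ^ (q - 1) +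
        ENNReal.ofReal (hausdorffYoungGap q ε * (1 - 10 * ε)⁻¹ ^ (q - 1)) *
          ∑' n, ‖a n ξ‖ₑ ^ q := fun ξ =>
    hcs.lintegral_enorm_tsum_rpow_le
      (hVs.of_nonneg_of_le (fun _ => norm_nonneg _) fun n => hale n ξ) hq hε hε1
  have hmq : ∀ n, Measurable fun ξ => ‖a n ξ‖ₑ ^ q := fun n =>
    (hac n).measurable.enorm.pow_const q
  have hmp : ∀ n, Measurable fun ξ => ‖a n ξ‖ₑ ^ (q / (q - 1)) := fun n =>
    (hac n).measurable.enorm.pow_const _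
  have hI₂ : ∫⁻ ξ, ∑' n, ‖a n ξ‖ₑ ^ q ≤ fourierB q d ^ q * ∑' n, V n ^ (q - 1) := by
    rw [lintegral_tsum fun n => (hmq n).aemeasurable, ← ENNReal.tsum_mul_left]
    exact ENNReal.tsum_le_tsum haq
  -- Jensen with exponent `q - 1` and weights `Vₙ`: the factor `Vₙ^{q-1}` from the slice bound
  -- cancels exactly, so the sum reassembles to `B^q |E|^{q-1}` without loss.
  have hI₁ : ∫⁻ ξ, (∑' n, ‖a n ξ‖ₑ ^ (q / (q - 1))) ^ (q - 1) ≤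
      fourierB q d ^ q * (∑' n, V n) ^ (q - 1) := by
    have hexp : ∀ y : ℝ≥0∞, (y ^ (q / (q - 1))) ^ (q - 1) = y ^ q := fun y => by
      rw [← ENNReal.rpow_mul, div_mul_cancel₀ _ (by linarith : q - 1 ≠ 0)]
    calc ∫⁻ ξ, (∑' n, ‖a n ξ‖ₑ ^ (q / (q - 1))) ^ (q - 1)
        ≤ ∫⁻ ξ, (∑' n, V n) ^ (q - 1 - 1) *
            ∑' n, V n * (‖a n ξ‖ₑ ^ (q / (q - 1)) / V n) ^ (q - 1) := by
          refine lintegral_mono fun ξ => ENNReal.tsum_rpow_le_weighted V _ (fun n => (hVtop n).ne)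
            (fun n hn => ?_) (by linarith)
          have : a n ξ = 0 := norm_le_zero_iff.1 ((hale n ξ).trans (by simp [hn]))
          rw [this, enorm_zero, ENNReal.zero_rpow_of_pos (div_pos hq0 (by linarith))]
      _ = (∑' n, V n) ^ (q - 1 - 1) *
            ∑' n, ∫⁻ ξ, V n * (‖a n ξ‖ₑ ^ (q / (q - 1)) / V n) ^ (q - 1) := by
          rw [lintegral_const_mul' _ _ (ENNReal.rpow_ne_top_of_nonneg (by linarith) hVsum),
            lintegral_tsum fun n =>
              ((((hmp n).div_const _).pow_const _).const_mul _).aemeasurable]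
      _ ≤ (∑' n, V n) ^ (q - 1 - 1) * ∑' n, fourierB q d ^ q * V n := by
          gcongr with n
          rcases eq_or_ne (V n) 0 with h0 | h0
          · simp [h0]
          · have hinv : ∀ ξ, V n * (‖a n ξ‖ₑ ^ (q / (q - 1)) / V n) ^ (q - 1) =
                V n * (V n ^ (q - 1))⁻¹ * ‖a n ξ‖ₑ ^ q := fun ξ => by
              rw [ENNReal.div_rpow_of_nonneg _ _ (by linarith), hexp, div_eq_mul_inv]
              ring
            simp_rw [hinv]
            rw [lintegral_const_mul _ (hmq n)]
            calc V n * (V n ^ (q - 1))⁻¹ * ∫⁻ ξ, ‖a n ξ‖ₑ ^ q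
                ≤ V n * (V n ^ (q - 1))⁻¹ * (fourierB q d ^ q * V n ^ (q - 1)) := by
                  gcongr; exact haq n
              _ = fourierB q d ^ q * V n * ((V n ^ (q - 1))⁻¹ * V n ^ (q - 1)) := by ring
              _ = fourierB q d ^ q * V n := by
                  rw [ENNReal.inv_mul_cancel (by simp [h0, (hVtop n).ne])
                    (ENNReal.rpow_ne_top_of_nonneg (by linarith) (hVtop n).ne), mul_one]
      _ = fourierB q d ^ q * (∑' n, V n) ^ (q - 1) := by
          rw [ENNReal.tsum_mul_left, mul_left_comm]
          congr 1
          conv_lhs => rw [← ENNReal.rpow_one (∑' n, V n), ← ENNReal.rpow_mul, one_mul]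
          rw [← ENNReal.rpow_add_of_nonneg _ _ (by linarith) zero_le_one]
          congr 1; ring
  rw [dualMeasure, lintegral_prod_symm _ (hfc.measurable.enorm.pow_const q).aemeasurable]
  refine (lintegral_mono hpt).trans ?_
  rw [lintegral_add_right _ ((Measurable.tsum hmq).const_mul _),
    lintegral_const_mul' _ _ ENNReal.ofReal_ne_top, lintegral_const_mul' _ _ ENNReal.ofReal_ne_top,
    mul_add, hsum, mul_left_comm, mul_left_comm (fourierB q d ^ q)]
  gcongr

end Lifted

/-! ### Choice of parameters and conclusion. -/

/-- The cost of a dominant coefficient tends to 1 as `ε → 0`, while `t^{q-2} < 1` is fixed. -/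
lemma exists_gap_parameter {q t : ℝ} (hq : 2 < q) (ht0 : 0 ≤ t) (ht1 : t < 1) :
    ∃ ε : ℝ, 0 < ε ∧ ε ≤ 1 / 100 ∧ (1 - 10 * ε)⁻¹ ^ (q - 1) * t ^ (q - 2) < 1 := by
  have hlt : t ^ (q - 2) < 1 := Real.rpow_lt_one ht0 ht1 (by linarith)
  have hcont : ContinuousAt (fun ε : ℝ => (1 - 10 * ε)⁻¹ ^ (q - 1) * t ^ (q - 2)) 0 := by
    refine ContinuousAt.mul (ContinuousAt.rpow_const (ContinuousAt.inv₀ (by fun_prop) (by simp))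
      (Or.inr (by linarith))) continuousAt_const
  have hev : ∀ᶠ ε in 𝓝[>] (0 : ℝ), (1 - 10 * ε)⁻¹ ^ (q - 1) * t ^ (q - 2) < 1 :=
    (hcont.eventually_lt_const (by simpa using hlt)).filter_mono nhdsWithin_le_nhds
  obtain ⟨ε, h1, h2⟩ := (hev.and (Ioc_mem_nhdsGT (by norm_num : (0 : ℝ) < 1 / 100))).exists
  exact ⟨ε, h2.1, h2.2, h1⟩

/-- If the Fourier transform of `f` is large compared with the constant obtained from the mixed
Hausdorff--Young inequality, then one slice carries almost all of the measure. -/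
lemma MajorizedBy.exists_slice_ge {κ d : ℕ} {q ε t δ : ℝ} (hq : 2 < q) (hε : 0 < ε)
    (hε1 : ε ≤ 1 / 100) (ht : 0 ≤ t) (hδ : δ ≤ 1)
    (hc : 1 - hausdorffYoungGap q ε + hausdorffYoungGap q ε *
      ((1 - 10 * ε)⁻¹ ^ (q - 1) * t ^ (q - 2)) < (1 - δ) ^ q)
    {E : Set (LiftedSpace κ d)} {f : LiftedSpace κ d → ℂ}
    (hE : NullMeasurableSet E (liftedMeasure κ d)) (hEtop : liftedMeasure κ d E < ∞)
    (hf0 : ¬ f =ᵐ[liftedMeasure κ d] 0) (h : MajorizedBy (liftedMeasure κ d) f E)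
    (hlarge : ENNReal.ofReal (1 - δ) * fourierB q d *
      (liftedMeasure κ d E) ^ (1 / q.conjExponent) ≤
        eLpNorm (liftedFourier f) (ENNReal.ofReal q) (dualMeasure κ d)) :
    ∃ m : Fin κ → ℤ, ENNReal.ofReal t * liftedMeasure κ d E ≤ volume (slice E m) := by
  have hq0 : 0 < q := by linarith
  have hgap := hausdorffYoungGap_pos hq hε hε1
  have hgap1 := hausdorffYoungGap_lt_one q ε
  have hinv : 0 < 1 - 10 * ε := by linarith
  have hB0 : fourierB q d ≠ 0 := (fourierB_pos hq).ne'
  have hBtop : fourierB q d ≠ ∞ := ((fourierB_le_one hq).trans_lt ENNReal.one_lt_top).ne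
  -- The final comparison cancels `B^q |E|^{q-1}`, which must be neither zero nor infinite; `f ≠ 0`
  -- excludes the null case.
  have hV0 : liftedMeasure κ d E ≠ 0 := by
    intro h0
    have := h.lintegral_enorm_le
    rw [h0, nonpos_iff_eq_zero, lintegral_eq_zero_iff' h.1.enorm] at this
    refine hf0 ?_
    filter_upwards [this] with x hx
    simpa using hx
  have hmain := h.lintegral_liftedFourier_le hq hε hε1 hE hEtop
  have hsum := liftedMeasure_eq_tsum hE
  set V := liftedMeasure κ d E with hV
  by_contra! hcon
  have hslices : ∑' n, volume (slice E n) ^ (q - 1) ≤ ENNReal.ofReal (t ^ (q - 2)) * V ^ (q - 1) := by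
    have hadd : ∀ y : ℝ≥0∞, y ^ (q - 1) = y ^ (q - 2) * y := fun y => by
      conv_rhs => rw [← ENNReal.rpow_one y, ← ENNReal.rpow_mul, one_mul]
      rw [← ENNReal.rpow_add_of_nonneg _ _ (by linarith) zero_le_one]
      congr 1; ring
    calc ∑' n, volume (slice E n) ^ (q - 1)
        ≤ ∑' n, (ENNReal.ofReal t * V) ^ (q - 2) * volume (slice E n) := by
          refine ENNReal.tsum_le_tsum fun n => ?_
          rw [hadd]
          gcongr
          exact (hcon n).le
      _ = ENNReal.ofReal (t ^ (q - 2)) * V ^ (q - 1) := by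
          rw [ENNReal.tsum_mul_left, ← hsum, ENNReal.mul_rpow_of_nonneg _ _ (by linarith),
            ENNReal.ofReal_rpow_of_nonneg ht (by linarith), mul_assoc, ← hadd]
  have hlower : ENNReal.ofReal ((1 - δ) ^ q) * (fourierB q d ^ q * V ^ (q - 1)) ≤
      ∫⁻ z, ‖liftedFourier f z‖ₑ ^ q ∂dualMeasure κ d := by
    rw [eLpNorm_ofReal_eq _ hq0] at hlarge
    have h1 := ENNReal.rpow_le_rpow hlarge hq0.le
    rw [← ENNReal.rpow_mul, one_div_mul_cancel hq0.ne', ENNReal.rpow_one,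
      ENNReal.mul_rpow_of_nonneg _ _ hq0.le, ENNReal.mul_rpow_of_nonneg _ _ hq0.le,
      ← ENNReal.rpow_mul, ENNReal.ofReal_rpow_of_nonneg (by linarith) hq0.le] at h1
    have e : 1 / q.conjExponent * q = q - 1 := by
      have : q - 1 ≠ 0 := by linarith
      rw [Real.conjExponent]; field_simp
    rwa [e, mul_assoc] at h1
  have hupper : ∫⁻ z, ‖liftedFourier f z‖ₑ ^ q ∂dualMeasure κ d ≤
      ENNReal.ofReal (1 - hausdorffYoungGap q ε + hausdorffYoungGap q ε *
        ((1 - 10 * ε)⁻¹ ^ (q - 1) * t ^ (q - 2))) * (fourierB q d ^ q * V ^ (q - 1)) := by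
    refine hmain.trans ?_
    rw [ENNReal.ofReal_add (by linarith) (by positivity), ← mul_assoc (hausdorffYoungGap q ε),
      ENNReal.ofReal_mul (by positivity) (q := t ^ (q - 2))]
    calc _ ≤ fourierB q d ^ q * (ENNReal.ofReal (1 - hausdorffYoungGap q ε) * V ^ (q - 1) +
          ENNReal.ofReal (hausdorffYoungGap q ε * (1 - 10 * ε)⁻¹ ^ (q - 1)) *
            (ENNReal.ofReal (t ^ (q - 2)) * V ^ (q - 1))) := by gcongr
      _ = _ := by ring
  have hK0 : fourierB q d ^ q * V ^ (q - 1) ≠ 0 :=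
    mul_ne_zero (by simp [hB0, hBtop]) (by simp [hV0, hEtop.ne])
  have hKtop : fourierB q d ^ q * V ^ (q - 1) ≠ ∞ :=
    ENNReal.mul_ne_top (ENNReal.rpow_ne_top_of_nonneg hq0.le hBtop)
      (ENNReal.rpow_ne_top_of_nonneg (by linarith) hEtop.ne)
  have hfin := (ENNReal.mul_le_mul_iff_left hK0 hKtop).1 (hlower.trans hupper)
  rw [ENNReal.ofReal_le_ofReal_iff (by
    have : 0 ≤ hausdorffYoungGap q ε * ((1 - 10 * ε)⁻¹ ^ (q - 1) * t ^ (q - 2)) := by positivity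
    linarith)] at hfin
  linarith

theorem mainTheorem5 (d κ : ℕ) (hd : 1 ≤ d) (hκ : 1 ≤ κ) (p q : ℝ) (hq : 2 < q)
    (hp : p = q.conjExponent) :
    ∃ ρ : ℝ → ℝ, Tendsto ρ (𝓝[>] 0) (𝓝 0) ∧
      ∀ δ : ℝ, 0 < δ → δ < 1 →
        ∀ (E : Set (LiftedSpace κ d)) (f : LiftedSpace κ d → ℂ),
          NullMeasurableSet E (liftedMeasure κ d) →
          liftedMeasure κ d E < ∞ →
          MemLp f (ENNReal.ofReal p) (liftedMeasure κ d) →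
          ¬ f =ᵐ[liftedMeasure κ d] 0 →
          MajorizedBy (liftedMeasure κ d) f E →
          ENNReal.ofReal (1 - δ) * fourierB q d * (liftedMeasure κ d E) ^ (1 / p) ≤
            eLpNorm (liftedFourier f) (ENNReal.ofReal q) (dualMeasure κ d) →
          ∃ m : Fin κ → ℤ,
            ENNReal.ofReal (1 - ρ δ) * liftedMeasure κ d E ≤ volume (slice E m) := by

  subst hp
  obtain ⟨ρ, hρ, hP⟩ := exists_tendsto_zero_of_eventually
    (P := fun δ τ => δ < 1 → ∀ (E : Set (LiftedSpace κ d)) (f : LiftedSpace κ d → ℂ),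
      NullMeasurableSet E (liftedMeasure κ d) → liftedMeasure κ d E < ∞ →
      ¬ f =ᵐ[liftedMeasure κ d] 0 → MajorizedBy (liftedMeasure κ d) f E →
      ENNReal.ofReal (1 - δ) * fourierB q d * (liftedMeasure κ d E) ^ (1 / q.conjExponent) ≤
        eLpNorm (liftedFourier f) (ENNReal.ofReal q) (dualMeasure κ d) →
      ∃ m : Fin κ → ℤ, ENNReal.ofReal (1 - τ) * liftedMeasure κ d E ≤ volume (slice E m))
    (fun δ s t hst h hδ E f h1 h2 h3 h4 h5 => by
      obtain ⟨m, hm⟩ := h hδ E f h1 h2 h3 h4 h5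
      refine ⟨m, le_trans ?_ hm⟩
      gcongr)
    (fun δ _ E f _ _ _ _ _ => ⟨0, by simp⟩) fun τ hτ => by
      -- Order of choices: `τ` fixes `t`, then `t` fixes `ε` and hence the gap, and only then is `δ`
      -- taken small. The maximum covers `τ > 1`.
      set t := max (1 - τ) 0 with ht
      have ht1 : t < 1 := max_lt (by linarith) one_pos
      obtain ⟨ε, hε, hε1, hlt⟩ := exists_gap_parameter hq (le_max_right _ _ : 0 ≤ t) ht1
      have hgap := hausdorffYoungGap_pos hq hε hε1
      have hc : 1 - hausdorffYoungGap q ε + hausdorffYoungGap q ε *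
          ((1 - 10 * ε)⁻¹ ^ (q - 1) * t ^ (q - 2)) < 1 := by nlinarith
      have hcont : ContinuousAt (fun δ : ℝ => (1 - δ) ^ q) 0 :=
        ContinuousAt.rpow_const (by fun_prop) (Or.inr (by linarith))
      have hev := (hcont.eventually_const_lt (by simpa using hc)).filter_mono
        (nhdsWithin_le_nhds (s := Set.Ioi 0))
      filter_upwards [hev] with δ hδ hδ1 E f h1 h2 h3 h4 h5
      obtain ⟨m, hm⟩ := h4.exists_slice_ge hq hε hε1 (le_max_right _ _) hδ1.le hδ h1 h2 h3 h5
      refine ⟨m, le_trans ?_ hm⟩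
      gcongr
      exact le_max_left _ _
  exact ⟨ρ, hρ, fun δ hδ hδ1 E f h1 h2 _ h3 h4 h5 => hP δ hδ hδ1 E f h1 h2 h3 h4 h5⟩
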